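/- Let $(X_t)_{t\ge 0}$ be a strictly stationary AR(1) process, $X_t=\theta_0X_{t-1}+Z_t$ for $t=1,2,\dots$, where $|\theta_0|<1$ and the errors $Z_1,Z_2,\dots$ are independent and identically distributed with finite variance and with median $0$ (their mean need not be $0$). Assume that the distribution function $F$ of $Z_t$ has a density $f$ which is continuous at $0$ with $f(0)>0$, and that there are constants $c,\alpha,M>0$ such that $$|F(x)-F(0)-xf(0)|\le c\,|x|^{1+\alpha}\qquad\text{for all } |x|\le M .$$ For each $n$ let $\hat\theta_2=\hat\theta_{2,n}$ be a least absolute deviations estimator of $\theta_0$, that is, any measurable choice of $$\hat\theta_{2,n}\in\arg\min_{\theta\in\mathbb R}\frac1n\sum_{t=2}^n|X_t-\theta X_{t-1}| .$$ Then $0<EX_t^2<\infty$ and, as $n\to\infty$, $$\sqrt n\,(\hat\theta_{2,n}-\theta_0)\ \xrightarrow{d}\ N\!\left(0,\ \frac{1}{4f(0)^2\,EX_t^2}\right).$$ -/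

import Mathlib

open MeasureTheory ProbabilityTheory Filter

namespace LADAR1

/-- Strict stationarity of a real process `(X_t)_{t ≥ 0}`: every shifted process
`(X_{t+k})_{t ≥ 0}` has the same law, on the space of real sequences, as `(X_t)_{t ≥ 0}`. -/
def StrictlyStationary {Ω : Type*} [MeasurableSpace Ω] (μ : Measure Ω) (X : ℕ → Ω → ℝ) : Prop :=
  ∀ k : ℕ, IdentDistrib (fun ω (t : ℕ) ↦ X (t + k) ω) (fun ω (t : ℕ) ↦ X t ω) μ μ

/-- `(X_t)_{t ≥ 0}` is a strictly stationary AR(1) process with parameter `θ` and errors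
`(Z_t)_{t ≥ 1}`: one has `|θ| < 1`, `X_t = θ X_{t-1} + Z_t` almost surely for `t = 1, 2, …`, and
the errors `Z_1, Z_2, …` are independent, identically distributed, with finite variance.
(The value `Z 0` plays no role.) -/
structure IsStationaryAR1 {Ω : Type*} [MeasurableSpace Ω] (μ : Measure Ω) (θ : ℝ)
    (X Z : ℕ → Ω → ℝ) : Prop where
  abs_lt_one : |θ| < 1
  recursion : ∀ t : ℕ, ∀ᵐ ω ∂μ, X (t + 1) ω = θ * X t ω + Z (t + 1) ω
  indep : iIndepFun (fun t : ℕ ↦ Z (t + 1)) μ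
  ident : ∀ t : ℕ, IdentDistrib (Z (t + 1)) (Z 1) μ μ
  memLp_two : MemLp (Z 1) 2 μ
  stationary : StrictlyStationary μ X

/-- `m` is a median of the distribution `ν` on the real line. -/
def IsMedian (ν : Measure ℝ) (m : ℝ) : Prop :=
  1 / 2 ≤ ν.real (Set.Iic m) ∧ 1 / 2 ≤ ν.real (Set.Ici m)

/-- `f` is a probability density function, with respect to Lebesgue measure, of the random
variable `Y`. -/
structure IsDensityOf {Ω : Type*} [MeasurableSpace Ω] (μ : Measure Ω) (f : ℝ → ℝ)
    (Y : Ω → ℝ) : Prop where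
  measurable : Measurable f
  nonneg : ∀ x, 0 ≤ f x
  hasLaw : HasLaw Y (volume.withDensity fun x ↦ ENNReal.ofReal (f x)) μ

/-- The local expansion condition at zero on a distribution function `F` with density `f`:
`|F(x) - F(0) - x f(0)| ≤ c |x|^{1+α}` for all `|x| ≤ M`, for some `c, α, M > 0`. -/
def LocalExpansionAtZero (F f : ℝ → ℝ) : Prop :=
  ∃ c > 0, ∃ α > 0, ∃ M > 0, ∀ x : ℝ, |x| ≤ M →
    |F x - F 0 - x * f 0| ≤ c * |x| ^ (1 + α : ℝ)

/-- The least absolute deviations criterion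
`θ ↦ n⁻¹ ∑_{t=2}^n |X_t - θ X_{t-1}|` computed from a sequence `x` of observations. -/
noncomputable def ladCriterion (x : ℕ → ℝ) (n : ℕ) (θ : ℝ) : ℝ :=
  (1 / (n : ℝ)) * ∑ t ∈ Finset.Icc 2 n, |x t - θ * x (t - 1)|

/-- `θhat` is a least absolute deviations estimator: for each sample size `n`, `θhat n` is a random
variable which almost surely minimizes the criterion over all real `θ`. The minimizer need not be
unique; any measurable choice is allowed. -/
structure IsLADEstimator {Ω : Type*} [MeasurableSpace Ω] (μ : Measure Ω) (X : ℕ → Ω → ℝ)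
    (θhat : ℕ → Ω → ℝ) : Prop where
  aemeasurable : ∀ n, AEMeasurable (θhat n) μ
  isMin : ∀ n, ∀ᵐ ω ∂μ, ∀ θ : ℝ,
    ladCriterion (fun t ↦ X t ω) n (θhat n ω) ≤ ladCriterion (fun t ↦ X t ω) n θ

end LADAR1

/-!
The LAD criterion is convex, so its minimizer is located by the sign of its derivative. In the
local parameter `b = √n (θ - θ₀)` the derivative at `b = a` is, up to a positive factor and a sign,
the score `S_N(a) = N^{-1/2} ∑ x_s sign (ζ_s - a N^{-1/2} x_s)`: if `S_N(a) > 0` the minimizer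
lies in `[a, ∞)`, if `S_N(a) < 0` it lies in `(-∞, a]` (`mul_sum_sign_nonneg`). Hence, if for each
fixed `a` the score converges in distribution to `G - k a` with `G` a centred Gaussian and `k > 0`,
the distribution functions of the minimizers are squeezed to that of `G / k`
(`tendstoInDistribution_of_score`); no tightness argument is needed.

With `v = E x_0²`, the limit of the score comes from two facts. At `a = 0`,
`S_N(0) = N^{-1/2} ∑ x_s sign ζ_s` is a martingale with bracket `N⁻¹ ∑ x_s²`, and it tends to
`N(0, v)` (`CausalAR1.tendstoInDistribution_signScore`). For other `a`, the conditional mean of the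
sign of `ζ_s - y` is `1 - 2 F(y) ≈ -2 f(0) y`, so the drift of the score is about
`-2 f(0) a N⁻¹ ∑ x_s²`, while the difference of the martingale parts has vanishing second moment;
hence `S_N(a) = S_N(0) - 2 f(0) v a + o(1)` in `L¹`
(`CausalAR1.tendsto_integral_abs_ladScore_sub`).
Thus `k = 2 f(0) v`, and the limit variance is `v / k² = 1 / (4 f(0)² v)`.

The central limit theorem is proved by characteristic functions. The coefficients are switched off
once the bracket exceeds a level, which makes the bracket bounded without destroying
predictability. Since a fair sign has characteristic function `cos`, multiplying the exponential of
the martingale by `exp` of half its bracket gives a product whose expectation telescopes to `1` up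
to the sum of the gaps `|cos u - exp (-u² / 2)|`
(`norm_integral_compensated_exp_sub_one_le`).

Both facts use the independence of `x_s` and `ζ_s`, which is not part of the hypotheses and is
derived from stationarity: `x_k = θ^k x_0 + S_k` where `S_k` depends only on the innovations before
time `k`, so `(x_k, ζ_k, ζ_{k+1}, …)`, which has the same law as `(x_0, ζ_0, ζ_1, …)`,
is close to having independent components, and `k → ∞` gives exact independence
(`RegularAR1.indepFun_zero_innov`).
The law of large numbers for `N⁻¹ ∑ x_s²` needs no ergodic theorem: squaring the recursion and
summing expresses `(1 - θ²) ∑ x_s²` through `∑ ζ_s²`, a martingale, a centred linear term and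
boundary terms (`CausalAR1.sum_sq_sub_eq`).
-/

/-! ### Stationary solutions are independent of the future innovations -/

namespace LADAR1

open scoped Topology

/-- A stationary AR(1) process all of whose coordinates are measurable and whose recursion holds
at every sample point. The innovation `ζ t` is the error entering `x (t + 1)`. -/
structure RegularAR1 {Ω : Type*} [MeasurableSpace Ω] (μ : Measure Ω) (θ : ℝ)
    (x ζ : ℕ → Ω → ℝ) : Prop where
  abs_lt_one : |θ| < 1
  recursion : ∀ t ω, x (t + 1) ω = θ * x t ω + ζ t ω
  measurable_x : ∀ t, Measurable (x t)
  measurable_innov : ∀ t, Measurable (ζ t)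
  indep : iIndepFun ζ μ
  ident : ∀ t, IdentDistrib (ζ t) (ζ 0) μ μ
  memLp_innov : MemLp (ζ 0) 2 μ
  stationary : StrictlyStationary μ x

/-- The solution of the recursion `x (t + 1) = θ * x t + ζ t` started at `ξ`. -/
def arPath {Ω : Type*} (θ : ℝ) (ξ : Ω → ℝ) (ζ : ℕ → Ω → ℝ) : ℕ → Ω → ℝ
  | 0 => ξ
  | t + 1 => fun ω ↦ θ * arPath θ ξ ζ t ω + ζ t ω

theorem measurable_arPath {Ω : Type*} {m : MeasurableSpace Ω} {θ : ℝ} {ζ : ℕ → Ω → ℝ} {k : ℕ}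
    (hζ : ∀ t < k, Measurable[m] (ζ t)) : Measurable[m] (arPath θ 0 ζ k) := by
  induction k with
  | zero => exact measurable_const
  | succ k ih =>
    exact ((ih fun t ht ↦ hζ t (by omega)).const_mul θ).add (hζ k (by omega))

variable {Ω : Type*} [mΩ : MeasurableSpace Ω] {μ : Measure Ω} {θ : ℝ}

theorem StrictlyStationary.identDistrib {X : ℕ → Ω → ℝ} (h : StrictlyStationary μ X) (t : ℕ) :
    IdentDistrib (X t) (X 0) μ μ := by
  simpa [Function.comp_def] using (h t).comp (measurable_pi_apply 0)

theorem StrictlyStationary.aemeasurable {X : ℕ → Ω → ℝ} (h : StrictlyStationary μ X) (t : ℕ) :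
    AEMeasurable (X t) μ :=
  (h.identDistrib t).aemeasurable_fst

theorem StrictlyStationary.congr {X Y : ℕ → Ω → ℝ} (h : StrictlyStationary μ X)
    (hXY : ∀ t, X t =ᵐ[μ] Y t) : StrictlyStationary μ Y := by
  intro k
  have hall : ∀ᵐ ω ∂μ, ∀ t, X t ω = Y t ω := ae_all_iff.2 hXY
  have e1 : (fun ω (t : ℕ) ↦ X (t + k) ω) =ᵐ[μ] fun ω t ↦ Y (t + k) ω := by
    filter_upwards [hall] with ω hω
    funext t
    exact hω _
  have e2 : (fun ω (t : ℕ) ↦ X t ω) =ᵐ[μ] fun ω t ↦ Y t ω := by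
    filter_upwards [hall] with ω hω
    funext t
    exact hω _
  exact ((IdentDistrib.of_ae_eq (h k).aemeasurable_fst e1).symm.trans (h k)).trans
    (IdentDistrib.of_ae_eq (h k).aemeasurable_snd e2)

/-- Dropping the first observation of a stationary AR(1) process leaves a stationary AR(1)
process. -/
theorem IsStationaryAR1.shift {X Z : ℕ → Ω → ℝ} (h : IsStationaryAR1 μ θ X Z) :
    IsStationaryAR1 μ θ (fun t ↦ X (t + 1)) (fun t ↦ Z (t + 1)) where
  abs_lt_one := h.abs_lt_one
  recursion t := h.recursion (t + 1)
  indep := h.indep.precomp (g := fun t ↦ t + 1) (add_left_injective 1)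
  ident t := (h.ident (t + 1)).trans (h.ident 1).symm
  memLp_two := (h.ident 1).symm.memLp_snd h.memLp_two
  stationary k := by
    have := (h.stationary k).comp (u := fun (x : ℕ → ℝ) (t : ℕ) ↦ x (t + 1)) (by fun_prop)
    simpa [Function.comp_def, add_right_comm] using this

/-- Up to null sets a stationary AR(1) process is regular: the recursion is rerun at every sample
point from measurable versions of the initial value and of the errors. -/
theorem IsStationaryAR1.exists_regular {X Z : ℕ → Ω → ℝ} (h : IsStationaryAR1 μ θ X Z) :
    ∃ x ζ : ℕ → Ω → ℝ, RegularAR1 μ θ x ζ ∧ (∀ t, X t =ᵐ[μ] x t) ∧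
      ∀ t, Z (t + 1) =ᵐ[μ] ζ t := by
  have hZ t : AEMeasurable (Z (t + 1)) μ := (h.ident t).aemeasurable_fst
  set ζ : ℕ → Ω → ℝ := fun t ↦ (hZ t).mk _ with hζ
  have hZζ t : Z (t + 1) =ᵐ[μ] ζ t := (hZ t).ae_eq_mk
  have hX0 : AEMeasurable (X 0) μ := h.stationary.aemeasurable 0
  set x := arPath θ (hX0.mk _) ζ with hx
  have hXx t : X t =ᵐ[μ] x t := by
    induction t with
    | zero => exact hX0.ae_eq_mk
    | succ t ih =>
      filter_upwards [ih, hZζ t, h.recursion t] with ω h1 h2 h3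
      rw [h3, h1, h2]
      rfl
  have hζm t : Measurable (ζ t) := (hZ t).measurable_mk
  have hid t : IdentDistrib (Z (t + 1)) (ζ t) μ μ := IdentDistrib.of_ae_eq (hZ t) (hZζ t)
  refine ⟨x, ζ, ⟨h.abs_lt_one, fun _ _ ↦ rfl, fun t ↦ ?_, hζm, ?_, fun t ↦ ?_, ?_, ?_⟩, hXx, hZζ⟩
  · induction t with
    | zero => exact hX0.measurable_mk
    | succ t ih => exact (ih.const_mul θ).add (hζm t)
  · exact (iIndepFun_congr hZζ).1 h.indep
  · exact ((hid t).symm.trans (h.ident t)).trans (hid 0)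
  · exact (hid 0).memLp_snd h.memLp_two
  · exact h.stationary.congr hXx

namespace RegularAR1

variable {x ζ : ℕ → Ω → ℝ}

/-- The contribution of the first `k` innovations to `x k`. -/
theorem eq_pow_mul_add_arPath (h : RegularAR1 μ θ x ζ) (k : ℕ) (ω : Ω) :
    x k ω = θ ^ k * x 0 ω + arPath θ 0 ζ k ω := by
  induction k with
  | zero => simp [arPath]
  | succ k ih => rw [h.recursion, ih, arPath]; ring

/-- The first `k` innovations are independent of the later ones. -/
theorem indepFun_arPath_tail (h : RegularAR1 μ θ x ζ) (k : ℕ) :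
    IndepFun (arPath θ 0 ζ k) (fun ω t ↦ ζ (t + k) ω) μ := by
  have key := indep_iSup_of_disjoint (fun i ↦ (h.measurable_innov i).comap_le) h.indep
    (S := {i | i < k}) (T := {i | k ≤ i})
    (Set.disjoint_left.2 fun i (hi : i < k) (hi' : k ≤ i) ↦ by omega)
  rw [IndepFun_iff_Indep]
  refine indep_of_indep_of_le_left (indep_of_indep_of_le_right key ?_) ?_
  · rw [← measurable_iff_comap_le]
    refine @measurable_pi_lambda _ _ _ (_) _ _ fun t ↦ ?_
    exact (comap_measurable (ζ (t + k))).mono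
      (le_iSup₂_of_le (f := fun i (_ : i ∈ {i | k ≤ i}) ↦
        MeasurableSpace.comap (ζ i) inferInstance) (t + k) (Nat.le_add_left k t) le_rfl) le_rfl
  · rw [← measurable_iff_comap_le]
    refine measurable_arPath fun t ht ↦ ?_
    exact (comap_measurable (ζ t)).mono
      (le_iSup₂_of_le (f := fun i (_ : i ∈ {i | i < k}) ↦
        MeasurableSpace.comap (ζ i) inferInstance) t ht le_rfl) le_rfl

/-- The innovations are a function of the path, so stationarity of `x` carries over to the pair of
the current value and all later innovations. -/
theorem identDistrib_prod_tail (h : RegularAR1 μ θ x ζ) (k : ℕ) :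
    IdentDistrib (fun ω ↦ (x k ω, fun t ↦ ζ (t + k) ω)) (fun ω ↦ (x 0 ω, fun t ↦ ζ t ω)) μ μ := by
  have := (h.stationary k).comp
    (u := fun (y : ℕ → ℝ) ↦ (y 0, fun t : ℕ ↦ y (t + 1) - θ * y t)) (by fun_prop)
  convert this using 2
  · ext1
    · simp
    · ext t
      simp [add_right_comm t 1 k, h.recursion]
  · ext1
    · simp
    · ext t
      simp [h.recursion]

/-- The contribution `θ ^ k * x 0` of the initial value is negligible; no moment of `x 0` is needed
because the exponential is bounded. -/
theorem tendsto_integral_norm_exp_sub_one [IsProbabilityMeasure μ] (h : RegularAR1 μ θ x ζ)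
    (u : ℝ) :
    Tendsto (fun k : ℕ ↦ ∫ ω, ‖Complex.exp ((u * (θ ^ k * x 0 ω) : ℝ) * Complex.I) - 1‖ ∂μ)
      atTop (𝓝 0) := by
  have hx := h.measurable_x 0
  have := tendsto_integral_of_dominated_convergence (μ := μ)
    (F := fun (k : ℕ) ω ↦ ‖Complex.exp ((u * (θ ^ k * x 0 ω) : ℝ) * Complex.I) - 1‖)
    (f := fun _ ↦ (0 : ℝ)) (fun _ ↦ (2 : ℝ)) (fun k ↦ by fun_prop) (integrable_const _) ?_ ?_
  · simpa using this
  · intro k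
    refine ae_of_all _ fun ω ↦ ?_
    rw [norm_norm]
    refine (norm_sub_le _ _).trans ?_
    rw [Complex.norm_exp_ofReal_mul_I, norm_one]
    norm_num
  · refine ae_of_all _ fun ω ↦ ?_
    have h0 : Tendsto (fun k : ℕ ↦ u * (θ ^ k * x 0 ω)) atTop (𝓝 (u * (0 * x 0 ω))) :=
      ((tendsto_pow_atTop_nhds_zero_of_abs_lt_one h.abs_lt_one).mul_const _).const_mul _
    have hc : Continuous fun v : ℝ ↦ ‖Complex.exp ((v : ℝ) * Complex.I) - 1‖ := by fun_prop
    simpa [Function.comp_def] using (hc.tendsto _).comp h0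

/-- Stationarity forces causality: `x 0` is independent of all later innovations. Indeed
`(x 0, ζ 0, ζ 1, …)` has the law of `(x k, ζ k, ζ (k + 1), …)`, where `x k` differs by
`θ ^ k * x 0` from a function of `ζ 0, …, ζ (k - 1)`. -/
theorem indepFun_zero_innov [IsProbabilityMeasure μ] (h : RegularAR1 μ θ x ζ) :
    IndepFun (x 0) (fun ω t ↦ ζ t ω) μ := by
  have hxm := h.measurable_x
  have hζm := h.measurable_innov
  have hSm k : Measurable (arPath θ 0 ζ k) := measurable_arPath fun t _ ↦ hζm t
  have htm k : Measurable (fun ω (t : ℕ) ↦ ζ (t + k) ω) :=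
    measurable_pi_lambda _ fun t ↦ hζm _
  have htm0 : Measurable (fun ω (t : ℕ) ↦ ζ t ω) := htm 0
  let e : ℝ → ℂ := fun v ↦ Complex.exp ((v : ℝ) * Complex.I)
  have hem : Measurable e := by fun_prop
  have he1 v : ‖e v‖ = 1 := Complex.norm_exp_ofReal_mul_I v
  have headd v w : e (v + w) = e v * e w := by
    simp only [e]; rw [← Complex.exp_add]; push_cast; ring_nf
  -- Factorization for `exp (i u x 0)` and events of the innovations; uniqueness of characteristic
  -- functions, applied to `μ` restricted to such an event, then gives independence.
  have key (u : ℝ) (B : Set (ℕ → ℝ)) (hB : MeasurableSet B) :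
      ∫ ω, e (u * x 0 ω) * B.indicator (fun _ ↦ (1 : ℂ)) (fun t ↦ ζ t ω) ∂μ
        = (∫ ω, e (u * x 0 ω) ∂μ) *
          ∫ ω, B.indicator (fun _ ↦ (1 : ℂ)) (fun t ↦ ζ t ω) ∂μ := by
    set b : (ℕ → ℝ) → ℂ := B.indicator (fun _ ↦ (1 : ℂ)) with hb
    have hbm : Measurable b := measurable_const.indicator hB
    have hb1 z : ‖b z‖ ≤ 1 := by
      simp only [hb, Set.indicator]; split_ifs <;> simp
    set δ : ℕ → ℝ := fun k ↦ ∫ ω, ‖e (u * (θ ^ k * x 0 ω)) - 1‖ ∂μ with hδ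
    have hdiff (k : ℕ) (g : Ω → ℂ) (hg : Measurable g) (hg1 : ∀ ω, ‖g ω‖ ≤ 1) :
        ‖(∫ ω, e (u * x k ω) * g ω ∂μ) - ∫ ω, e (u * arPath θ 0 ζ k ω) * g ω ∂μ‖ ≤ δ k := by
      have hS := hSm k
      have hx := hxm k
      have hx0 := hxm 0
      have i1 : Integrable (fun ω ↦ e (u * x k ω) * g ω) μ :=
        Integrable.of_bound (by fun_prop) 1 (ae_of_all _ fun ω ↦ by
          rw [norm_mul, he1, one_mul]; exact hg1 ω)
      have i2 : Integrable (fun ω ↦ e (u * arPath θ 0 ζ k ω) * g ω) μ :=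
        Integrable.of_bound (by fun_prop) 1 (ae_of_all _ fun ω ↦ by
          rw [norm_mul, he1, one_mul]; exact hg1 ω)
      rw [← integral_sub i1 i2]
      refine norm_integral_le_of_norm_le ?_ (ae_of_all _ fun ω ↦ ?_)
      · refine Integrable.of_bound (by fun_prop) 2 (ae_of_all _ fun ω ↦ ?_)
        rw [norm_norm]
        refine (norm_sub_le _ _).trans ?_
        rw [he1, norm_one]; norm_num
      · rw [← sub_mul, h.eq_pow_mul_add_arPath k ω, mul_add, headd, norm_mul]
        have : e (u * (θ ^ k * x 0 ω)) * e (u * arPath θ 0 ζ k ω) - e (u * arPath θ 0 ζ k ω)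
            = (e (u * (θ ^ k * x 0 ω)) - 1) * e (u * arPath θ 0 ζ k ω) := by ring
        rw [this, norm_mul, he1, mul_one]
        exact mul_le_of_le_one_right (norm_nonneg _) (hg1 ω)
    have hbound (k : ℕ) :
        ‖(∫ ω, e (u * x 0 ω) * b (fun t ↦ ζ t ω) ∂μ)
          - (∫ ω, e (u * x 0 ω) ∂μ) * ∫ ω, b (fun t ↦ ζ t ω) ∂μ‖ ≤ 2 * δ k := by
      have hid := h.identDistrib_prod_tail k
      have e1 : ∫ ω, e (u * x k ω) * b (fun t ↦ ζ (t + k) ω) ∂μ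
          = ∫ ω, e (u * x 0 ω) * b (fun t ↦ ζ t ω) ∂μ :=
        (hid.comp (u := fun p : ℝ × (ℕ → ℝ) ↦ e (u * p.1) * b p.2) (by fun_prop)).integral_eq
      have e2 : ∫ ω, e (u * x k ω) ∂μ = ∫ ω, e (u * x 0 ω) ∂μ :=
        (hid.comp (u := fun p : ℝ × (ℕ → ℝ) ↦ e (u * p.1)) (by fun_prop)).integral_eq
      have e3 : ∫ ω, b (fun t ↦ ζ (t + k) ω) ∂μ = ∫ ω, b (fun t ↦ ζ t ω) ∂μ :=
        (hid.comp (u := fun p : ℝ × (ℕ → ℝ) ↦ b p.2) (by fun_prop)).integral_eq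
      have e4 : ∫ ω, e (u * arPath θ 0 ζ k ω) * b (fun t ↦ ζ (t + k) ω) ∂μ
          = (∫ ω, e (u * arPath θ 0 ζ k ω) ∂μ) * ∫ ω, b (fun t ↦ ζ (t + k) ω) ∂μ := by
        have hf : Measurable fun v : ℝ ↦ e (u * v) := by fun_prop
        exact (h.indepFun_arPath_tail k).integral_fun_comp_mul_comp (hSm k).aemeasurable
          (htm k).aemeasurable hf.aestronglyMeasurable hbm.aestronglyMeasurable
      have d1 := hdiff k (fun ω ↦ b (fun t ↦ ζ (t + k) ω)) (hbm.comp (htm k)) (fun ω ↦ hb1 _)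
      have d2 := hdiff k (fun _ ↦ 1) measurable_const (fun ω ↦ by simp)
      simp only [mul_one] at d2
      have hI : ‖∫ ω, b (fun t ↦ ζ t ω) ∂μ‖ ≤ 1 := by
        have := norm_integral_le_of_norm_le_const (μ := μ)
          (ae_of_all _ fun ω ↦ hb1 (fun t ↦ ζ t ω))
        simpa using this
      rw [e4, e3, e1] at d1
      rw [e2] at d2
      set I0 := ∫ ω, e (u * x 0 ω) * b (fun t ↦ ζ t ω) ∂μ
      set E0 := ∫ ω, e (u * x 0 ω) ∂μ
      set Ek := ∫ ω, e (u * arPath θ 0 ζ k ω) ∂μ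
      set P := ∫ ω, b (fun t ↦ ζ t ω) ∂μ
      calc ‖I0 - E0 * P‖ = ‖(I0 - Ek * P) - (E0 - Ek) * P‖ := by congr 1; ring
        _ ≤ ‖I0 - Ek * P‖ + ‖E0 - Ek‖ * ‖P‖ := by
          rw [← norm_mul]; exact norm_sub_le _ _
        _ ≤ δ k + δ k * 1 := by gcongr
        _ = 2 * δ k := by ring
    have hlim : Tendsto (fun k ↦ 2 * δ k) atTop (𝓝 0) := by
      have := (h.tendsto_integral_norm_exp_sub_one u).const_mul 2
      rwa [mul_zero] at this
    exact sub_eq_zero.1 (norm_le_zero_iff.1 (ge_of_tendsto' hlim hbound))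
  rw [indepFun_iff_measure_inter_preimage_eq_mul]
  intro A B hA hB
  set D : Set Ω := (fun ω t ↦ ζ t ω) ⁻¹' B with hD
  have hDm : MeasurableSet D := htm0 hB
  have hmap : (μ.restrict D).map (x 0) = μ D • μ.map (x 0) := by
    have : IsFiniteMeasure (μ D • μ.map (x 0)) := Measure.smul_finite _ (measure_ne_top _ _)
    refine Measure.ext_of_charFun (funext fun u ↦ ?_)
    have hfm : Measurable fun v : ℝ ↦ Complex.exp (u * v * Complex.I) := by fun_prop
    rw [charFun_apply_real, charFun_apply_real,
      integral_map (hxm 0).aemeasurable hfm.aestronglyMeasurable,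
      integral_smul_measure, integral_map (hxm 0).aemeasurable hfm.aestronglyMeasurable]
    have := key u B hB
    simp only [e] at this
    push_cast at this
    have hind : (fun ω ↦ B.indicator (fun _ ↦ (1 : ℂ)) (fun t ↦ ζ t ω))
        = D.indicator fun _ ↦ 1 := rfl
    rw [hind, integral_indicator_const _ hDm] at this
    rw [← integral_indicator hDm, Complex.real_smul, mul_comm]
    rw [Complex.real_smul, mul_one] at this
    refine Eq.trans (integral_congr_ae (ae_of_all _ fun ω ↦ ?_)) this
    by_cases hω : ω ∈ D
    · have : (fun t ↦ ζ t ω) ∈ B := hω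
      simp [hω, this]
    · have : (fun t ↦ ζ t ω) ∉ B := hω
      simp [hω, this]
  have := congrArg (fun ν ↦ ν A) hmap
  simp only [Measure.smul_apply, smul_eq_mul] at this
  rw [Measure.map_apply (hxm 0) hA, Measure.map_apply (hxm 0) hA,
    Measure.restrict_apply (hxm 0 hA)] at this
  rw [this, mul_comm]

end RegularAR1
end LADAR1

/-! ### Square integrability and causality -/

namespace LADAR1
open scoped Topology

/-- A stationary AR(1) process together with a filtration that makes it causal: the innovation
`ζ t` entering `x (t + 1)` is independent of the information `ℱ t` available at time `t`. -/
structure CausalAR1 {Ω : Type*} [mΩ : MeasurableSpace Ω] (μ : Measure Ω) (θ : ℝ)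
    (x ζ : ℕ → Ω → ℝ) (ℱ : Filtration ℕ mΩ) : Prop where
  abs_lt_one : |θ| < 1
  recursion : ∀ t ω, x (t + 1) ω = θ * x t ω + ζ t ω
  adapted : ∀ t, Measurable[ℱ t] (x t)
  adapted_innov : ∀ t, Measurable[ℱ (t + 1)] (ζ t)
  indep : ∀ t, Indep (ℱ t) (MeasurableSpace.comap (ζ t) inferInstance) μ
  pairwise_indep : Pairwise fun s t ↦ IndepFun (ζ s) (ζ t) μ
  ident : ∀ t, IdentDistrib (x t) (x 0) μ μ
  ident_innov : ∀ t, IdentDistrib (ζ t) (ζ 0) μ μ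
  memLp : MemLp (x 0) 2 μ
  memLp_innov : MemLp (ζ 0) 2 μ

/-- Convexity of the square. -/
theorem mul_add_sq_le {θ : ℝ} (hθ : |θ| < 1) (a b : ℝ) :
    (θ * a + b) ^ 2 ≤ |θ| * a ^ 2 + b ^ 2 / (1 - |θ|) := by
  have h1 : 0 < 1 - |θ| := by linarith
  have h2 : (θ * a + b) ^ 2 = |θ| ^ 2 * |a| ^ 2 + 2 * (θ * a * b) + |b| ^ 2 := by
    rw [sq_abs, sq_abs, sq_abs]; ring
  have h3 : θ * a * b ≤ |θ| * |a| * |b| := by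
    rw [← abs_mul, ← abs_mul]; exact le_abs_self _
  have h4 : 0 ≤ |θ| * ((1 - |θ|) * |a| - |b|) ^ 2 := mul_nonneg (abs_nonneg _) (sq_nonneg _)
  have h5 := mul_le_mul_of_nonneg_right h3 h1.le
  rw [← sub_le_iff_le_add', le_div_iff₀ h1, h2, ← sq_abs a, ← sq_abs b]
  nlinarith

variable {Ω : Type*} [mΩ : MeasurableSpace Ω] {μ : Measure Ω} {θ : ℝ}

namespace RegularAR1

variable {x ζ : ℕ → Ω → ℝ}

theorem integrable_innov_sq (h : RegularAR1 μ θ x ζ) (t : ℕ) :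
    Integrable (fun ω ↦ ζ t ω ^ 2) μ :=
  ((h.ident t).symm.memLp_snd h.memLp_innov).integrable_sq

/-- Solutions started at zero have second moments bounded uniformly in time. -/
theorem arPath_sq_le (h : RegularAR1 μ θ x ζ) (k : ℕ) :
    ∫⁻ ω, ENNReal.ofReal (arPath θ 0 ζ k ω ^ 2) ∂μ
      ≤ ENNReal.ofReal ((∫ ω, ζ 0 ω ^ 2 ∂μ) / (1 - |θ|) ^ 2) := by
  have hθ : 0 < 1 - |θ| := by linarith [h.abs_lt_one]
  have hq : 0 ≤ ∫ ω, ζ 0 ω ^ 2 ∂μ := integral_nonneg fun ω ↦ sq_nonneg _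
  induction k with
  | zero => simp [arPath]
  | succ k ih =>
    have hζ := h.measurable_innov
    have hS : Measurable (arPath θ 0 ζ k) := measurable_arPath fun t _ ↦ hζ t
    have hzint : ∫⁻ ω, ENNReal.ofReal (ζ k ω ^ 2 / (1 - |θ|)) ∂μ
        = ENNReal.ofReal ((∫ ω, ζ 0 ω ^ 2 ∂μ) / (1 - |θ|)) := by
      rw [← ofReal_integral_eq_lintegral_ofReal ((h.integrable_innov_sq k).div_const _)
        (ae_of_all _ fun ω ↦ by positivity), integral_div]
      congr 2
      exact ((h.ident k).comp (u := fun v : ℝ ↦ v ^ 2) (by fun_prop)).integral_eq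
    calc ∫⁻ ω, ENNReal.ofReal (arPath θ 0 ζ (k + 1) ω ^ 2) ∂μ
        ≤ ∫⁻ ω, (ENNReal.ofReal |θ| * ENNReal.ofReal (arPath θ 0 ζ k ω ^ 2)
            + ENNReal.ofReal (ζ k ω ^ 2 / (1 - |θ|))) ∂μ := by
          refine lintegral_mono fun ω ↦ ?_
          rw [← ENNReal.ofReal_mul (abs_nonneg _), ← ENNReal.ofReal_add (by positivity)
            (by positivity)]
          exact ENNReal.ofReal_le_ofReal (mul_add_sq_le h.abs_lt_one _ _)
      _ = ENNReal.ofReal |θ| * ∫⁻ ω, ENNReal.ofReal (arPath θ 0 ζ k ω ^ 2) ∂μ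
            + ENNReal.ofReal ((∫ ω, ζ 0 ω ^ 2 ∂μ) / (1 - |θ|)) := by
          rw [lintegral_add_left (by fun_prop), lintegral_const_mul _ (by fun_prop), hzint]
      _ ≤ ENNReal.ofReal |θ| * ENNReal.ofReal ((∫ ω, ζ 0 ω ^ 2 ∂μ) / (1 - |θ|) ^ 2)
            + ENNReal.ofReal ((∫ ω, ζ 0 ω ^ 2 ∂μ) / (1 - |θ|)) := by gcongr
      _ = ENNReal.ofReal ((∫ ω, ζ 0 ω ^ 2 ∂μ) / (1 - |θ|) ^ 2) := by
          rw [← ENNReal.ofReal_mul (abs_nonneg _), ← ENNReal.ofReal_add (by positivity)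
            (by positivity)]
          congr 1
          field_simp
          ring

/-- The stationary law has a finite second moment. For a truncation level `K`, the expectation of
`min (x 0 ^ 2) K` equals that of `min (x k ^ 2) K`, in which the initial value is negligible as
`k → ∞`; the bound that results does not depend on `K`. -/
theorem memLp_two [IsProbabilityMeasure μ] (h : RegularAR1 μ θ x ζ) : MemLp (x 0) 2 μ := by
  have hx := h.measurable_x
  have hζ := h.measurable_innov
  have hS k : Measurable (arPath θ 0 ζ k) := measurable_arPath fun t _ ↦ hζ t
  set C : ENNReal := ENNReal.ofReal 2 *
    ENNReal.ofReal ((∫ ω, ζ 0 ω ^ 2 ∂μ) / (1 - |θ|) ^ 2) with hC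
  have hK (K : ℕ) : ∫⁻ ω, min (ENNReal.ofReal (x 0 ω ^ 2)) K ∂μ ≤ C := by
    have hlim : Tendsto (fun k : ℕ ↦
        ∫⁻ ω, min (ENNReal.ofReal (2 * (θ ^ k * x 0 ω) ^ 2)) K ∂μ + C) atTop (𝓝 (0 + C)) := by
      refine Tendsto.add_const _ ?_
      have := tendsto_lintegral_of_dominated_convergence (μ := μ)
        (F := fun (k : ℕ) ω ↦ min (ENNReal.ofReal (2 * (θ ^ k * x 0 ω) ^ 2)) K)
        (f := fun _ ↦ 0) (fun _ ↦ (K : ENNReal)) (fun k ↦ by have := hx 0; fun_prop)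
        (fun k ↦ ae_of_all _ fun ω ↦ min_le_right _ _) (by simp) ?_
      · simpa using this
      · refine ae_of_all _ fun ω ↦ ?_
        have h0 : Tendsto (fun k : ℕ ↦ 2 * (θ ^ k * x 0 ω) ^ 2) atTop
            (𝓝 (2 * (0 * x 0 ω) ^ 2)) :=
          (((tendsto_pow_atTop_nhds_zero_of_abs_lt_one h.abs_lt_one).mul_const _).pow 2).const_mul _
        have h1 := (ENNReal.tendsto_ofReal h0).min (tendsto_const_nhds (x := (K : ENNReal)))
        simpa using h1
    rw [zero_add] at hlim
    refine ge_of_tendsto' hlim fun k ↦ ?_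
    have hid := (h.stationary.identDistrib k).comp
      (u := fun v : ℝ ↦ min (ENNReal.ofReal (v ^ 2)) K) (by fun_prop)
    have e1 : ∫⁻ ω, min (ENNReal.ofReal (x k ω ^ 2)) K ∂μ
        = ∫⁻ ω, min (ENNReal.ofReal (x 0 ω ^ 2)) K ∂μ := hid.lintegral_eq
    rw [← e1]
    calc ∫⁻ ω, min (ENNReal.ofReal (x k ω ^ 2)) K ∂μ
        ≤ ∫⁻ ω, (min (ENNReal.ofReal (2 * (θ ^ k * x 0 ω) ^ 2)) K
            + ENNReal.ofReal 2 * ENNReal.ofReal (arPath θ 0 ζ k ω ^ 2)) ∂μ := by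
          refine lintegral_mono fun ω ↦ ?_
          have : ENNReal.ofReal (x k ω ^ 2) ≤ ENNReal.ofReal (2 * (θ ^ k * x 0 ω) ^ 2)
              + ENNReal.ofReal 2 * ENNReal.ofReal (arPath θ 0 ζ k ω ^ 2) := by
            rw [← ENNReal.ofReal_mul (by norm_num), ← ENNReal.ofReal_add (by positivity)
              (by positivity)]
            refine ENNReal.ofReal_le_ofReal ?_
            rw [h.eq_pow_mul_add_arPath k ω]
            nlinarith [sq_nonneg (θ ^ k * x 0 ω - arPath θ 0 ζ k ω)]
          simp only
          rw [min_add]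
          exact le_min ((min_le_left _ _).trans this) ((min_le_right _ _).trans le_self_add)
      _ = ∫⁻ ω, min (ENNReal.ofReal (2 * (θ ^ k * x 0 ω) ^ 2)) K ∂μ
            + ENNReal.ofReal 2 * ∫⁻ ω, ENNReal.ofReal (arPath θ 0 ζ k ω ^ 2) ∂μ := by
          have := hS k
          rw [lintegral_add_right _ (by fun_prop), lintegral_const_mul _ (by fun_prop)]
      _ ≤ _ := by
          rw [hC]
          gcongr
          exact h.arPath_sq_le k
  have hfin : ∫⁻ ω, ENNReal.ofReal (x 0 ω ^ 2) ∂μ ≤ C := by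
    have hsup ω : ENNReal.ofReal (x 0 ω ^ 2) = ⨆ K : ℕ, min (ENNReal.ofReal (x 0 ω ^ 2)) K := by
      refine le_antisymm ?_ (iSup_le fun K ↦ min_le_left _ _)
      obtain ⟨K, hK⟩ := exists_nat_ge (x 0 ω ^ 2)
      refine le_iSup_of_le K (le_min le_rfl ?_)
      rw [← ENNReal.ofReal_natCast]
      exact ENNReal.ofReal_le_ofReal hK
    rw [lintegral_congr hsup]
    rw [lintegral_iSup (fun K ↦ by have := hx 0; fun_prop)]
    · exact iSup_le hK
    · intro K L hKL ω
      exact min_le_min le_rfl (by exact_mod_cast hKL)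
  rw [memLp_two_iff_integrable_sq (hx 0).aestronglyMeasurable]
  refine ⟨((hx 0).pow_const 2).aestronglyMeasurable, ?_⟩
  rw [hasFiniteIntegral_iff_ofReal (ae_of_all _ fun ω ↦ sq_nonneg _)]
  exact hfin.trans_lt (ENNReal.mul_lt_top ENNReal.ofReal_lt_top ENNReal.ofReal_lt_top)

/-- The initial value followed by the innovations. -/
def source (x ζ : ℕ → Ω → ℝ) : ℕ → Ω → ℝ
  | 0 => x 0
  | t + 1 => ζ t

theorem measurable_source (h : RegularAR1 μ θ x ζ) (t : ℕ) : Measurable (source x ζ t) := by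
  cases t with
  | zero => exact h.measurable_x 0
  | succ t => exact h.measurable_innov t

theorem iIndepFun_source [IsProbabilityMeasure μ] (h : RegularAR1 μ θ x ζ) :
    iIndepFun (source x ζ) μ := by
  have key (A : Set ℝ) (hA : MeasurableSet A) (T : Finset ℕ) (s : ℕ → Set ℝ)
      (hs : ∀ t ∈ T, MeasurableSet (s t)) :
      μ (x 0 ⁻¹' A ∩ ⋂ t ∈ T, ζ t ⁻¹' s t) = μ (x 0 ⁻¹' A) * ∏ t ∈ T, μ (ζ t ⁻¹' s t) := by
    have hB : MeasurableSet (⋂ t ∈ T, (fun z : ℕ → ℝ ↦ z t) ⁻¹' s t) :=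
      Finset.measurableSet_biInter _ fun t ht ↦ measurable_pi_apply t (hs t ht)
    have e : (⋂ t ∈ T, ζ t ⁻¹' s t)
        = (fun ω t ↦ ζ t ω) ⁻¹' (⋂ t ∈ T, (fun z : ℕ → ℝ ↦ z t) ⁻¹' s t) := by
      ext ω; simp
    rw [e, h.indepFun_zero_innov.measure_inter_preimage_eq_mul _ _ hA hB, ← e,
      h.indep.measure_inter_preimage_eq_mul T hs]
  rw [iIndepFun_iff_measure_inter_preimage_eq_mul]
  intro S sets hsets
  set T : Finset ℕ := S.preimage Nat.succ Nat.succ_injective.injOn with hT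
  have hTm : ∀ t ∈ T, MeasurableSet (sets (t + 1)) := fun t ht ↦
    hsets _ (by simpa [hT] using ht)
  by_cases h0 : 0 ∈ S
  · have hS : S = insert 0 (T.map ⟨Nat.succ, Nat.succ_injective⟩) := by
      ext i
      cases i <;> simp [hT, h0]
    have h0' : 0 ∉ T.map ⟨Nat.succ, Nat.succ_injective⟩ := by simp
    rw [hS, Finset.prod_insert h0', Finset.prod_map, Finset.set_biInter_insert]
    have := key (sets 0) (hsets 0 h0) T (fun t ↦ sets (t + 1)) hTm
    simpa [source] using this
  · have hS : S = T.map ⟨Nat.succ, Nat.succ_injective⟩ := by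
      ext i
      cases i <;> simp [hT, h0]
    rw [hS, Finset.prod_map]
    have := key Set.univ MeasurableSet.univ T (fun t ↦ sets (t + 1)) hTm
    simpa [source] using this

/-- The filtration is generated by the initial value and the past innovations. -/
theorem exists_causal [IsProbabilityMeasure μ] (h : RegularAR1 μ θ x ζ) :
    ∃ ℱ : Filtration ℕ mΩ, CausalAR1 μ θ x ζ ℱ := by
  have hsm t : StronglyMeasurable (source x ζ t) := (h.measurable_source t).stronglyMeasurable
  set ℱ := Filtration.natural (source x ζ) hsm with hℱ
  have hsource t : Measurable[ℱ t] (source x ζ t) :=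
    (Filtration.stronglyAdapted_natural hsm t).measurable
  have hinn t : Measurable[ℱ (t + 1)] (ζ t) := hsource (t + 1)
  refine ⟨ℱ, h.abs_lt_one, h.recursion, fun t ↦ ?_, hinn, fun t ↦ ?_, fun s t hst ↦
    h.indep.indepFun hst, h.stationary.identDistrib, h.ident, h.memLp_two, h.memLp_innov⟩
  · induction t with
    | zero => exact hsource 0
    | succ t ih =>
      have e : x (t + 1) = fun ω ↦ θ * x t ω + ζ t ω := funext (h.recursion t)
      rw [e]
      exact ((ih.mono (ℱ.mono t.le_succ) le_rfl).const_mul θ).add (hinn t)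
  · exact (h.iIndepFun_source.indep_comap_natural_of_lt hsm (Nat.lt_succ_self t)).symm

end RegularAR1
end LADAR1

/-! ### Law of large numbers for the squared process -/

namespace LADAR1
open scoped Topology

variable {Ω : Type*} [mΩ : MeasurableSpace Ω] {μ : Measure Ω} {θ : ℝ}

/-- Jensen's inequality for the square. -/
theorem integral_abs_le_sqrt [IsProbabilityMeasure μ] {f : Ω → ℝ} (hf : MemLp f 2 μ) :
    ∫ ω, |f ω| ∂μ ≤ √(∫ ω, f ω ^ 2 ∂μ) := by
  refine Real.le_sqrt_of_sq_le ?_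
  have hv := variance_nonneg |f| μ
  rw [variance_eq_sub hf.abs] at hv
  simp only [Pi.pow_apply, Pi.abs_apply, sq_abs] at hv
  linarith

namespace CausalAR1

variable {x ζ : ℕ → Ω → ℝ} {ℱ : Filtration ℕ mΩ}

theorem measurable (h : CausalAR1 μ θ x ζ ℱ) (t : ℕ) : Measurable (x t) :=
  (h.adapted t).mono (ℱ.le t) le_rfl

theorem measurable_innov (h : CausalAR1 μ θ x ζ ℱ) (t : ℕ) : Measurable (ζ t) :=
  (h.adapted_innov t).mono (ℱ.le _) le_rfl

theorem indepFun_of_measurable (h : CausalAR1 μ θ x ζ ℱ) {γ : Type*} [MeasurableSpace γ] {t : ℕ}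
    {H : Ω → γ} (hH : Measurable[ℱ t] H) : IndepFun H (ζ t) μ := by
  rw [IndepFun_iff_Indep]
  exact indep_of_indep_of_le_left (h.indep t) hH.comap_le

theorem identDistrib_prod [IsProbabilityMeasure μ] (h : CausalAR1 μ θ x ζ ℱ) (t : ℕ) :
    IdentDistrib (fun ω ↦ (x t ω, ζ t ω)) (fun ω ↦ (x 0 ω, ζ 0 ω)) μ μ :=
  (h.ident t).prodMk (h.ident_innov t) (h.indepFun_of_measurable (h.adapted t))
    (h.indepFun_of_measurable (h.adapted 0))

/-- Conditioning on the past: in an expectation involving `ζ t` and quantities known at time `t`,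
the innovation can be integrated out first. -/
theorem integral_comp_innov [IsProbabilityMeasure μ] (h : CausalAR1 μ θ x ζ ℱ) {γ E : Type*}
    [MeasurableSpace γ] [NormedAddCommGroup E] [NormedSpace ℝ E] {t : ℕ}
    {H : Ω → γ} (hH : Measurable[ℱ t] H) {F : γ × ℝ → E} (hF : StronglyMeasurable F)
    (hint : Integrable (fun ω ↦ F (H ω, ζ t ω)) μ) :
    ∫ ω, F (H ω, ζ t ω) ∂μ = ∫ ω, ∫ z, F (H ω, z) ∂(μ.map (ζ 0)) ∂μ := by
  have hHm : Measurable H := hH.mono (ℱ.le t) le_rfl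
  have hζ := h.measurable_innov t
  have hlaw : μ.map (fun ω ↦ (H ω, ζ t ω)) = (μ.map H).prod (μ.map (ζ 0)) := by
    rw [(h.indepFun_of_measurable hH).map_prod_eq_prod_map_map hHm.aemeasurable hζ.aemeasurable,
      (h.ident_innov t).map_eq]
  have : IsProbabilityMeasure (μ.map H) := Measure.isProbabilityMeasure_map hHm.aemeasurable
  have : IsProbabilityMeasure (μ.map (ζ 0)) :=
    Measure.isProbabilityMeasure_map (h.measurable_innov 0).aemeasurable
  have hpair : AEMeasurable (fun ω ↦ (H ω, ζ t ω)) μ := (hHm.prodMk hζ).aemeasurable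
  have hint' : Integrable F ((μ.map H).prod (μ.map (ζ 0))) := by
    rw [← hlaw, integrable_map_measure hF.aestronglyMeasurable hpair]
    exact hint
  rw [← integral_map hpair hF.aestronglyMeasurable, hlaw, integral_prod _ hint',
    integral_map hHm.aemeasurable]
  exact hF.integral_prod_right'.aestronglyMeasurable

theorem memLp_comp [IsProbabilityMeasure μ] (h : CausalAR1 μ θ x ζ ℱ) {Φ : ℝ × ℝ → ℝ}
    (hΦ : Measurable Φ) (hL : MemLp (fun ω ↦ Φ (x 0 ω, ζ 0 ω)) 2 μ) (t : ℕ) :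
    MemLp (fun ω ↦ Φ (x t ω, ζ t ω)) 2 μ :=
  ((h.identDistrib_prod t).comp hΦ).symm.memLp_snd hL

/-- Sums of martingale differences `Φ (x s, ζ s)` have orthogonal summands. -/
theorem integral_sum_sq [IsProbabilityMeasure μ] (h : CausalAR1 μ θ x ζ ℱ) {Φ : ℝ × ℝ → ℝ}
    (hΦ : Measurable Φ) (h0 : ∀ a, ∫ z, Φ (a, z) ∂(μ.map (ζ 0)) = 0)
    (hL : MemLp (fun ω ↦ Φ (x 0 ω, ζ 0 ω)) 2 μ) (N : ℕ) :
    ∫ ω, (∑ s ∈ Finset.range N, Φ (x s ω, ζ s ω)) ^ 2 ∂μ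
      = N * ∫ ω, Φ (x 0 ω, ζ 0 ω) ^ 2 ∂μ := by
  induction N with
  | zero => simp
  | succ N ih =>
    set S : Ω → ℝ := fun ω ↦ ∑ s ∈ Finset.range N, Φ (x s ω, ζ s ω) with hS
    set d : Ω → ℝ := fun ω ↦ Φ (x N ω, ζ N ω) with hd
    have hSL : MemLp S 2 μ := memLp_finsetSum _ fun s _ ↦ h.memLp_comp hΦ hL s
    have hdL : MemLp d 2 μ := h.memLp_comp hΦ hL N
    have hSm : Measurable[ℱ N] S := by
      refine Finset.measurable_fun_sum _ fun s hs ↦ hΦ.comp (Measurable.prodMk ?_ ?_)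
      · exact (h.adapted s).mono (ℱ.mono (Finset.mem_range.1 hs).le) le_rfl
      · exact (h.adapted_innov s).mono (ℱ.mono (Finset.mem_range.1 hs)) le_rfl
    have hSd : Integrable (fun ω ↦ S ω * d ω) μ := hSL.integrable_mul hdL
    have hcross : ∫ ω, S ω * d ω ∂μ = 0 := by
      have hF : Measurable fun p : (ℝ × ℝ) × ℝ ↦ p.1.1 * Φ (p.1.2, p.2) := by fun_prop
      have := h.integral_comp_innov (hSm.prodMk (h.adapted N)) hF.stronglyMeasurable hSd
      simp only [integral_const_mul, h0, mul_zero, integral_zero] at this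
      exact this
    have hdsq : ∫ ω, d ω ^ 2 ∂μ = ∫ ω, Φ (x 0 ω, ζ 0 ω) ^ 2 ∂μ :=
      ((h.identDistrib_prod N).comp (u := fun p ↦ Φ p ^ 2) (by fun_prop)).integral_eq
    have e ω : (∑ s ∈ Finset.range (N + 1), Φ (x s ω, ζ s ω)) ^ 2
        = S ω ^ 2 + 2 * (S ω * d ω) + d ω ^ 2 := by
      rw [Finset.sum_range_succ]; simp only [hS, hd]; ring
    simp_rw [e]
    have i1 : Integrable (fun ω ↦ S ω ^ 2 + 2 * (S ω * d ω)) μ :=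
      hSL.integrable_sq.add (hSd.const_mul 2)
    rw [integral_add i1 hdL.integrable_sq,
      integral_add hSL.integrable_sq (hSd.const_mul 2), integral_const_mul, hcross, ih, hdsq]
    push_cast
    ring

theorem integral_abs_sum_le [IsProbabilityMeasure μ] (h : CausalAR1 μ θ x ζ ℱ) {Φ : ℝ × ℝ → ℝ}
    (hΦ : Measurable Φ) (h0 : ∀ a, ∫ z, Φ (a, z) ∂(μ.map (ζ 0)) = 0)
    (hL : MemLp (fun ω ↦ Φ (x 0 ω, ζ 0 ω)) 2 μ) (N : ℕ) :
    ∫ ω, |∑ s ∈ Finset.range N, Φ (x s ω, ζ s ω)| ∂μ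
      ≤ √N * √(∫ ω, Φ (x 0 ω, ζ 0 ω) ^ 2 ∂μ) := by
  rw [← Real.sqrt_mul (Nat.cast_nonneg N), ← h.integral_sum_sq hΦ h0 hL N]
  exact integral_abs_le_sqrt (memLp_finsetSum _ fun s _ ↦ h.memLp_comp hΦ hL s)

theorem memLp_x (h : CausalAR1 μ θ x ζ ℱ) (t : ℕ) : MemLp (x t) 2 μ :=
  (h.ident t).symm.memLp_snd h.memLp

theorem memLp_ζ (h : CausalAR1 μ θ x ζ ℱ) (t : ℕ) : MemLp (ζ t) 2 μ :=
  (h.ident_innov t).symm.memLp_snd h.memLp_innov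

theorem indepFun_zero (h : CausalAR1 μ θ x ζ ℱ) : IndepFun (x 0) (ζ 0) μ :=
  h.indepFun_of_measurable (h.adapted 0)

theorem integral_eq_of_stationary [IsProbabilityMeasure μ] (h : CausalAR1 μ θ x ζ ℱ) :
    (1 - θ) * ∫ ω, x 0 ω ∂μ = ∫ ω, ζ 0 ω ∂μ := by
  have h1 := (h.ident 1).integral_eq
  have e : ∫ ω, x 1 ω ∂μ = ∫ ω, (θ * x 0 ω + ζ 0 ω) ∂μ :=
    integral_congr_ae (ae_of_all _ fun ω ↦ h.recursion 0 ω)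
  rw [e, integral_add ((h.memLp.integrable one_le_two).const_mul θ)
    (h.memLp_innov.integrable one_le_two), integral_const_mul] at h1
  linarith

theorem integral_sq_eq_of_stationary [IsProbabilityMeasure μ] (h : CausalAR1 μ θ x ζ ℱ) :
    (1 - θ ^ 2) * ∫ ω, x 0 ω ^ 2 ∂μ
      = 2 * θ * ((∫ ω, x 0 ω ∂μ) * ∫ ω, ζ 0 ω ∂μ) + ∫ ω, ζ 0 ω ^ 2 ∂μ := by
  have h1 : ∫ ω, x 1 ω ^ 2 ∂μ = ∫ ω, x 0 ω ^ 2 ∂μ :=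
    ((h.ident 1).comp (u := fun v : ℝ ↦ v ^ 2) (by fun_prop)).integral_eq
  have e : ∫ ω, x 1 ω ^ 2 ∂μ
      = ∫ ω, (θ ^ 2 * x 0 ω ^ 2 + 2 * θ * (x 0 ω * ζ 0 ω) + ζ 0 ω ^ 2) ∂μ := by
    refine integral_congr_ae (ae_of_all _ fun ω ↦ ?_)
    simp only [h.recursion 0 ω]
    ring
  have hmul : Integrable (fun ω ↦ x 0 ω * ζ 0 ω) μ := h.memLp.integrable_mul h.memLp_innov
  have i1 : Integrable (fun ω ↦ θ ^ 2 * x 0 ω ^ 2 + 2 * θ * (x 0 ω * ζ 0 ω)) μ :=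
    (h.memLp.integrable_sq.const_mul _).add (hmul.const_mul _)
  rw [e, integral_add i1
    h.memLp_innov.integrable_sq, integral_add (h.memLp.integrable_sq.const_mul _)
    (hmul.const_mul _), integral_const_mul, integral_const_mul,
    h.indepFun_zero.integral_fun_mul_eq_mul_integral h.memLp.1 h.memLp_innov.1] at h1
  linarith

/-- Summing the squared recursion expresses `∑ x s ^ 2` through boundary terms, martingale sums and
a sum of i.i.d. variables. The innovations need not be centred, and `κ` is the multiple of the
recursion itself that removes the linear term `∑ x s` this produces. -/
theorem sum_sq_sub_eq [IsProbabilityMeasure μ] (h : CausalAR1 μ θ x ζ ℱ) {κ : ℝ}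
    (hκ : (1 - θ) * κ = 2 * θ * ∫ ω, ζ 0 ω ∂μ) (N : ℕ) (ω : Ω) :
    (1 - θ ^ 2) * ∑ s ∈ Finset.range N, (x s ω ^ 2 - ∫ ω, x 0 ω ^ 2 ∂μ)
      = (x 0 ω ^ 2 - x N ω ^ 2) + κ * (x 0 ω - x N ω)
        + 2 * θ * ∑ s ∈ Finset.range N, x s ω * (ζ s ω - ∫ ω, ζ 0 ω ∂μ)
        + κ * ∑ s ∈ Finset.range N, (ζ s ω - ∫ ω, ζ 0 ω ∂μ)
        + ∑ s ∈ Finset.range N, (ζ s ω ^ 2 - ∫ ω, ζ 0 ω ^ 2 ∂μ) := by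
  induction N with
  | zero => simp
  | succ N ih =>
    have h1 := h.integral_eq_of_stationary
    have h2 := h.integral_sq_eq_of_stationary
    have hm : κ * ∫ ω, ζ 0 ω ∂μ = 2 * θ * ((∫ ω, x 0 ω ∂μ) * ∫ ω, ζ 0 ω ∂μ) := by
      calc κ * ∫ ω, ζ 0 ω ∂μ = ((1 - θ) * κ) * ∫ ω, x 0 ω ∂μ := by rw [← h1]; ring
        _ = _ := by rw [hκ]; ring
    simp only [Finset.sum_range_succ, h.recursion N ω, mul_add] at ih ⊢
    linear_combination ih - h2 + hm - x N ω * hκ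

theorem tendsto_integral_abs_innov_sq [IsProbabilityMeasure μ] (h : CausalAR1 μ θ x ζ ℱ) :
    Tendsto (fun N : ℕ ↦ ∫ ω, |(N : ℝ)⁻¹ * ∑ s ∈ Finset.range N, ζ s ω ^ 2 - ∫ ω, ζ 0 ω ^ 2 ∂μ| ∂μ)
      atTop (𝓝 0) := by
  have hsq : Measurable fun v : ℝ ↦ v ^ 2 := by fun_prop
  have hL := strong_law_Lp (μ := μ) (p := 1) le_rfl (by simp) (fun s ω ↦ ζ s ω ^ 2)
    (memLp_one_iff_integrable.2 h.memLp_innov.integrable_sq)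
    (fun s t hst ↦ (h.pairwise_indep hst).comp hsq hsq)
    (fun s ↦ (h.ident_innov s).comp hsq)
  have := (ENNReal.tendsto_toReal ENNReal.zero_ne_top).comp hL
  simp only [ENNReal.toReal_zero] at this
  refine this.congr fun N ↦ ?_
  simp only [Function.comp_apply, smul_eq_mul]
  rw [eLpNorm_one_eq_lintegral_enorm, ← integral_norm_eq_lintegral_enorm]
  · simp only [Real.norm_eq_abs]
  · have := h.measurable_innov
    exact Measurable.aestronglyMeasurable (by fun_prop)

/-- The law of large numbers for `x s ^ 2`, in mean. -/
theorem tendsto_integral_abs_sq [IsProbabilityMeasure μ] (h : CausalAR1 μ θ x ζ ℱ) :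
    Tendsto (fun N : ℕ ↦ ∫ ω, |((N : ℝ) + 1)⁻¹ * ∑ s ∈ Finset.range N, x s ω ^ 2
      - ∫ ω, x 0 ω ^ 2 ∂μ| ∂μ) atTop (𝓝 0) := by
  set m := ∫ ω, ζ 0 ω ∂μ with hm
  set q := ∫ ω, ζ 0 ω ^ 2 ∂μ with hq
  set v := ∫ ω, x 0 ω ^ 2 ∂μ with hv
  have hθ1 : 0 < 1 - θ := by linarith [(abs_lt.1 h.abs_lt_one).2]
  have hθ2 : 0 < 1 - θ ^ 2 := by nlinarith [(abs_lt.1 h.abs_lt_one).1]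
  set κ := 2 * θ * m / (1 - θ) with hκ
  have hκ' : (1 - θ) * κ = 2 * θ * m := by rw [hκ]; field_simp
  have hv0 : 0 ≤ v := integral_nonneg fun ω ↦ sq_nonneg _
  set ν := μ.map (ζ 0) with hν
  have hζm := h.measurable_innov
  have hxm := h.measurable
  have hνp : IsProbabilityMeasure ν := Measure.isProbabilityMeasure_map (hζm 0).aemeasurable
  have hmν : ∫ z, z ∂ν = m := integral_map (hζm 0).aemeasurable (by fun_prop)
  have hzint : Integrable (fun z : ℝ ↦ z) ν :=
    (integrable_map_measure (by fun_prop) (hζm 0).aemeasurable).2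
      (h.memLp_innov.integrable one_le_two)
  have hc0 : ∫ z, (z - m) ∂ν = 0 := by
    rw [integral_sub hzint (integrable_const _), hmν]; simp
  have hcL : MemLp (fun ω ↦ ζ 0 ω - m) 2 μ := h.memLp_innov.sub (memLp_const m)
  -- the martingale sums, via orthogonality
  set A := √(∫ ω, (x 0 ω * (ζ 0 ω - m)) ^ 2 ∂μ)
  set B := √(∫ ω, (ζ 0 ω - m) ^ 2 ∂μ)
  have hxcL : MemLp (fun ω ↦ x 0 ω * (ζ 0 ω - m)) 2 μ := by
    have hind : IndepFun (x 0) (fun ω ↦ ζ 0 ω - m) μ :=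
      h.indepFun_zero.comp (φ := id) (ψ := fun z ↦ z - m) measurable_id (by fun_prop)
    rw [memLp_two_iff_integrable_sq (by fun_prop)]
    have := (hind.comp (φ := fun v : ℝ ↦ v ^ 2) (ψ := fun v : ℝ ↦ v ^ 2)
      (by fun_prop) (by fun_prop)).integrable_mul h.memLp.integrable_sq hcL.integrable_sq
    refine this.congr (ae_of_all _ fun ω ↦ ?_)
    simp [mul_pow]
  have hA N : ∫ ω, |∑ s ∈ Finset.range N, x s ω * (ζ s ω - m)| ∂μ ≤ √N * A :=
    h.integral_abs_sum_le (Φ := fun p ↦ p.1 * (p.2 - m)) (by fun_prop)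
      (fun a ↦ by rw [integral_const_mul, hc0, mul_zero]) hxcL N
  have hB N : ∫ ω, |∑ s ∈ Finset.range N, (ζ s ω - m)| ∂μ ≤ √N * B :=
    h.integral_abs_sum_le (Φ := fun p ↦ p.2 - m) (by fun_prop) (fun _ ↦ hc0) hcL N
  set ε : ℕ → ℝ := fun N ↦ ∫ ω, |(N : ℝ)⁻¹ * ∑ s ∈ Finset.range N, ζ s ω ^ 2 - q| ∂μ with hε
  have hεlim : Tendsto ε atTop (𝓝 0) := h.tendsto_integral_abs_innov_sq
  have hC N : ∫ ω, |∑ s ∈ Finset.range N, (ζ s ω ^ 2 - q)| ∂μ = N * ε N := by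
    rw [hε, ← integral_const_mul]
    refine integral_congr_ae (ae_of_all _ fun ω ↦ ?_)
    simp only
    rcases Nat.eq_zero_or_pos N with rfl | hN
    · simp
    · have hN' : (0 : ℝ) < N := by exact_mod_cast hN
      rw [← abs_of_pos hN', ← abs_mul, abs_of_pos hN', Finset.sum_sub_distrib]
      simp only [Finset.sum_const, Finset.card_range, nsmul_eq_mul]
      congr 1
      field_simp
  have i1 N : Integrable (fun ω ↦ x N ω ^ 2) μ := (h.memLp_x N).integrable_sq
  have i2 N : Integrable (x N) μ := (h.memLp_x N).integrable one_le_two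
  have i3 N : Integrable (fun ω ↦ ∑ s ∈ Finset.range N, x s ω * (ζ s ω - m)) μ :=
    integrable_finsetSum _ fun s _ ↦
      (h.memLp_x s).integrable_mul ((h.memLp_ζ s).sub (memLp_const m))
  have i4 N : Integrable (fun ω ↦ ∑ s ∈ Finset.range N, (ζ s ω - m)) μ :=
    integrable_finsetSum _ fun s _ ↦ ((h.memLp_ζ s).integrable one_le_two).sub (integrable_const m)
  have i5 N : Integrable (fun ω ↦ ∑ s ∈ Finset.range N, (ζ s ω ^ 2 - q)) μ :=
    integrable_finsetSum _ fun s _ ↦ (h.memLp_ζ s).integrable_sq.sub (integrable_const q)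
  set D := v + v + |κ| * ((∫ ω, |x 0 ω| ∂μ) + ∫ ω, |x 0 ω| ∂μ)
  have hbound (N : ℕ) : ∫ ω, |((N : ℝ) + 1)⁻¹ * ∑ s ∈ Finset.range N, x s ω ^ 2 - v| ∂μ
      ≤ ((N : ℝ) + 1)⁻¹ * ((1 - θ ^ 2)⁻¹ * (D + |2 * θ| * (√N * A) + |κ| * (√N * B) + N * ε N)
        + v) := by
    have hN : (0 : ℝ) < (N : ℝ) + 1 := by positivity
    have hpt ω : |((N : ℝ) + 1)⁻¹ * ∑ s ∈ Finset.range N, x s ω ^ 2 - v|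
        ≤ ((N : ℝ) + 1)⁻¹ * ((1 - θ ^ 2)⁻¹ * ((x 0 ω ^ 2 + x N ω ^ 2
          + |κ| * (|x 0 ω| + |x N ω|))
          + |2 * θ| * |∑ s ∈ Finset.range N, x s ω * (ζ s ω - m)|
          + |κ| * |∑ s ∈ Finset.range N, (ζ s ω - m)|
          + |∑ s ∈ Finset.range N, (ζ s ω ^ 2 - q)|) + v) := by
      have hid := h.sum_sq_sub_eq hκ' N ω
      rw [← hm, ← hv, ← hq] at hid
      have e1 : ((N : ℝ) + 1)⁻¹ * ∑ s ∈ Finset.range N, x s ω ^ 2 - v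
          = ((N : ℝ) + 1)⁻¹ * (∑ s ∈ Finset.range N, (x s ω ^ 2 - v) - v) := by
        rw [Finset.sum_sub_distrib]
        simp only [Finset.sum_const, Finset.card_range, nsmul_eq_mul]
        field_simp
        ring
      have e2 : ∑ s ∈ Finset.range N, (x s ω ^ 2 - v)
          = (1 - θ ^ 2)⁻¹ * ((1 - θ ^ 2) * ∑ s ∈ Finset.range N, (x s ω ^ 2 - v)) := by
        field_simp
      rw [e1, abs_mul, abs_of_pos (inv_pos.2 hN)]
      gcongr
      refine (abs_sub _ _).trans ?_
      rw [abs_of_nonneg hv0, e2, abs_mul, abs_of_pos (inv_pos.2 hθ2), hid]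
      gcongr
      refine (abs_add_le _ _).trans (add_le_add ((abs_add_le _ _).trans (add_le_add
        ((abs_add_le _ _).trans (add_le_add ((abs_add_le _ _).trans (add_le_add ?_ ?_)) ?_)) ?_))
        le_rfl)
      · refine (abs_sub _ _).trans ?_
        rw [abs_of_nonneg (sq_nonneg _), abs_of_nonneg (sq_nonneg _)]
      · rw [abs_mul]
        gcongr
        exact abs_sub _ _
      · rw [abs_mul]
      · rw [abs_mul]
    have j1 : Integrable (fun ω ↦ x 0 ω ^ 2 + x N ω ^ 2) μ := (i1 0).add (i1 N)
    have j2 : Integrable (fun ω ↦ |κ| * (|x 0 ω| + |x N ω|)) μ :=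
      ((i2 0).abs.add (i2 N).abs).const_mul _
    have j3 : Integrable (fun ω ↦ |2 * θ| * |∑ s ∈ Finset.range N, x s ω * (ζ s ω - m)|) μ :=
      (i3 N).abs.const_mul _
    have j4 : Integrable (fun ω ↦ |κ| * |∑ s ∈ Finset.range N, (ζ s ω - m)|) μ :=
      (i4 N).abs.const_mul _
    have j5 := (i5 N).abs
    have j12 : Integrable (fun ω ↦ x 0 ω ^ 2 + x N ω ^ 2 + |κ| * (|x 0 ω| + |x N ω|)) μ :=
      j1.add j2
    have j123 : Integrable (fun ω ↦ x 0 ω ^ 2 + x N ω ^ 2 + |κ| * (|x 0 ω| + |x N ω|)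
        + |2 * θ| * |∑ s ∈ Finset.range N, x s ω * (ζ s ω - m)|) μ :=
      j12.add j3
    have j1234 : Integrable (fun ω ↦ x 0 ω ^ 2 + x N ω ^ 2 + |κ| * (|x 0 ω| + |x N ω|)
        + |2 * θ| * |∑ s ∈ Finset.range N, x s ω * (ζ s ω - m)|
        + |κ| * |∑ s ∈ Finset.range N, (ζ s ω - m)|) μ :=
      j123.add j4
    have j12345 : Integrable (fun ω ↦ x 0 ω ^ 2 + x N ω ^ 2 + |κ| * (|x 0 ω| + |x N ω|)
        + |2 * θ| * |∑ s ∈ Finset.range N, x s ω * (ζ s ω - m)|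
        + |κ| * |∑ s ∈ Finset.range N, (ζ s ω - m)|
        + |∑ s ∈ Finset.range N, (ζ s ω ^ 2 - q)|) μ :=
      j1234.add j5
    have j6 := j12345.const_mul (1 - θ ^ 2)⁻¹
    have hsqN : ∫ ω, x N ω ^ 2 ∂μ = v :=
      ((h.ident N).comp (u := fun v : ℝ ↦ v ^ 2) (by fun_prop)).integral_eq
    have habsN : ∫ ω, |x N ω| ∂μ = ∫ ω, |x 0 ω| ∂μ :=
      ((h.ident N).comp (u := fun v : ℝ ↦ |v|) (by fun_prop)).integral_eq
    refine (integral_mono_of_nonneg (ae_of_all _ fun ω ↦ abs_nonneg _)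
      ((j6.add (integrable_const v)).const_mul _) (ae_of_all _ hpt)).trans ?_
    rw [integral_const_mul]
    refine mul_le_mul_of_nonneg_left ?_ (inv_pos.2 hN).le
    rw [integral_add' j6 (integrable_const v), integral_const_mul]
    refine add_le_add (mul_le_mul_of_nonneg_left ?_ (inv_pos.2 hθ2).le) (by simp)
    rw [integral_add j1234 j5, integral_add j123 j4, integral_add j12 j3, integral_add j1 j2,
      integral_add (i1 0) (i1 N), integral_const_mul, integral_const_mul, integral_const_mul,
      integral_add (i2 0).abs (i2 N).abs, hsqN, habsN, hC]
    gcongr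
    · exact hA N
    · exact hB N
  have hinv : Tendsto (fun N : ℕ ↦ ((N : ℝ) + 1)⁻¹) atTop (𝓝 0) := by
    simpa using tendsto_one_div_add_atTop_nhds_zero_nat (𝕜 := ℝ)
  have hsqrt : Tendsto (fun N : ℕ ↦ ((N : ℝ) + 1)⁻¹ * √N) atTop (𝓝 0) := by
    have h1 : Tendsto (fun N : ℕ ↦ √(((N : ℝ) + 1)⁻¹)) atTop (𝓝 0) := by
      have := (Real.continuous_sqrt.tendsto 0).comp hinv
      rwa [Real.sqrt_zero] at this
    refine squeeze_zero (fun N ↦ by positivity) (fun N ↦ ?_) h1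
    have hN : (0 : ℝ) < (N : ℝ) + 1 := by positivity
    rw [Real.sqrt_inv, inv_mul_le_iff₀ hN, ← div_eq_mul_inv, Real.div_sqrt]
    exact Real.sqrt_le_sqrt (by linarith)
  have hratio : Tendsto (fun N : ℕ ↦ ((N : ℝ) + 1)⁻¹ * (N * ε N)) atTop (𝓝 0) := by
    have h1 : Tendsto (fun N : ℕ ↦ ((N : ℝ) + 1)⁻¹ * N) atTop (𝓝 1) := by
      refine (tendsto_natCast_div_add_atTop (1 : ℝ)).congr fun N ↦ ?_
      rw [div_eq_inv_mul]
    simpa [mul_assoc] using h1.mul hεlim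
  have hlim : Tendsto (fun N : ℕ ↦ ((N : ℝ) + 1)⁻¹ * ((1 - θ ^ 2)⁻¹ *
      (D + |2 * θ| * (√N * A) + |κ| * (√N * B) + N * ε N) + v)) atTop (𝓝 0) := by
    have := (((((hinv.mul_const D).add (hsqrt.const_mul (|2 * θ| * A))).add
      (hsqrt.const_mul (|κ| * B))).add hratio).const_mul (1 - θ ^ 2)⁻¹).add (hinv.mul_const v)
    simp only [zero_mul, mul_zero, add_zero] at this
    refine this.congr fun N ↦ ?_
    ring
  exact squeeze_zero (fun N ↦ integral_nonneg fun ω ↦ abs_nonneg _) hbound hlim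

end CausalAR1
end LADAR1

/-! ### Signs, the scaling, and compensated exponentials -/

namespace LADAR1
open scoped Topology

@[fun_prop]
theorem measurable_sign : Measurable Real.sign :=
  Measurable.ite measurableSet_Iio measurable_const
    (Measurable.ite measurableSet_Ioi measurable_const measurable_const)

theorem abs_sign_le_one (r : ℝ) : |Real.sign r| ≤ 1 := by
  rcases Real.sign_apply_eq r with h | h | h <;> simp [h]

/-- The scaling `1 / √(N + 1)`, where `N + 1` is the sample size. -/
noncomputable def scale (N : ℕ) : ℝ := (√((N : ℝ) + 1))⁻¹

theorem scale_pos (N : ℕ) : 0 < scale N := by unfold scale; positivity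

theorem scale_sq (N : ℕ) : scale N ^ 2 = ((N : ℝ) + 1)⁻¹ := by
  rw [scale, inv_pow, Real.sq_sqrt (by positivity)]

theorem tendsto_scale : Tendsto scale atTop (𝓝 0) := by
  have hinv : Tendsto (fun N : ℕ ↦ ((N : ℝ) + 1)⁻¹) atTop (𝓝 0) := by
    simpa using tendsto_one_div_add_atTop_nhds_zero_nat (𝕜 := ℝ)
  have := (Real.continuous_sqrt.tendsto 0).comp hinv
  rw [Real.sqrt_zero] at this
  exact this.congr fun N ↦ Real.sqrt_inv _

/-- The distance between the characteristic functions of a fair sign and of a standard Gaussian. -/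
noncomputable def cosGap (v : ℝ) : ℝ := |Real.cos v - Real.exp (-(v ^ 2 / 2))|

theorem continuous_cosGap : Continuous cosGap := by
  unfold cosGap; fun_prop

theorem cosGap_zero : cosGap 0 = 0 := by simp [cosGap]

theorem cosGap_nonneg (v : ℝ) : 0 ≤ cosGap v := abs_nonneg _

theorem cosGap_le_sq (v : ℝ) : cosGap v ≤ v ^ 2 := by
  have h1 := Real.one_sub_sq_div_two_le_cos (x := v)
  have h2 := Real.cos_le_one v
  have h3 := Real.add_one_le_exp (-(v ^ 2 / 2))
  have h4 : Real.exp (-(v ^ 2 / 2)) ≤ 1 := Real.exp_le_one_iff.2 (by nlinarith [sq_nonneg v])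
  rw [cosGap, abs_le]
  constructor <;> nlinarith [sq_nonneg v]

theorem cosGap_le_pow_four {v : ℝ} (hv : |v| ≤ 1) : cosGap v ≤ v ^ 4 := by
  have h1 := abs_le.1 (Real.cos_bound hv)
  have hv2 : v ^ 2 ≤ 1 := (sq_le_one_iff_abs_le_one v).2 hv
  have h2 := abs_le.1 (Real.abs_exp_sub_one_sub_id_le (x := -(v ^ 2 / 2)) (by
    rw [abs_neg, abs_of_nonneg (by positivity)]; linarith))
  have h3 : |v| ^ 4 = v ^ 4 := by rw [show (4 : ℕ) = 2 * 2 from rfl, pow_mul, sq_abs, ← pow_mul]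
  rw [h3] at h1
  have h4 : (-(v ^ 2 / 2)) ^ 2 = v ^ 4 / 4 := by ring
  rw [h4] at h2
  have h5 : 0 ≤ v ^ 4 := by positivity
  rw [cosGap, abs_le]
  constructor <;> linarith [h1.1, h1.2, h2.1, h2.2]

theorem abs_one_sub_exp_le {y b : ℝ} (hb : 0 ≤ b) (hy : y ≤ b) :
    |1 - Real.exp y| ≤ Real.exp b * |y| := by
  have h1 := Real.add_one_le_exp y
  have h2 := Real.add_one_le_exp (-y)
  have h3 : Real.exp y * Real.exp (-y) = 1 := by rw [← Real.exp_add]; simp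
  have h4 : 1 ≤ Real.exp b := Real.one_le_exp hb
  have h5 : Real.exp y ≤ Real.exp b := Real.exp_le_exp.2 hy
  rcases le_total 0 y with hy0 | hy0
  · rw [abs_of_nonneg hy0, abs_of_nonpos (by linarith)]
    have := mul_le_mul_of_nonneg_left h2 (Real.exp_pos y).le
    nlinarith
  · rw [abs_of_nonpos hy0, abs_of_nonneg (by linarith [Real.exp_le_one_iff.2 hy0])]
    nlinarith

variable {Ω : Type*} [mΩ : MeasurableSpace Ω] {μ : Measure Ω} {θ : ℝ}

namespace CausalAR1

variable {x ζ : ℕ → Ω → ℝ} {ℱ : Filtration ℕ mΩ}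

/-- The exponential of a martingale transform of the signs of the innovations, compensated by half
its quadratic variation, has expectation close to one. -/
theorem norm_integral_compensated_exp_sub_one_le [IsProbabilityMeasure μ]
    (h : CausalAR1 μ θ x ζ ℱ)
    (hsign : ∀ a : ℝ, ∫ z, Complex.exp ((a * Real.sign z : ℝ) * Complex.I) ∂(μ.map (ζ 0))
      = Real.cos a)
    {v : ℕ → Ω → ℝ} (hv : ∀ s, Measurable[ℱ s] (v s)) {K : ℝ}
    (hK : ∀ n ω, ∑ s ∈ Finset.range n, v s ω ^ 2 ≤ K) (n : ℕ) :
    ‖(∫ ω, Complex.exp ((∑ s ∈ Finset.range n, v s ω * Real.sign (ζ s ω) : ℝ) * Complex.I)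
        * (Real.exp ((∑ s ∈ Finset.range n, v s ω ^ 2) / 2) : ℂ) ∂μ) - 1‖
      ≤ Real.exp (K / 2) * ∑ s ∈ Finset.range n, ∫ ω, cosGap (v s ω) ∂μ := by
  have hvm s : Measurable (v s) := (hv s).mono (ℱ.le s) le_rfl
  have hζm := h.measurable_innov
  have hgap : Measurable cosGap := continuous_cosGap.measurable
  induction n with
  | zero => simp
  | succ n ih =>
    set M : Ω → ℝ := fun ω ↦ ∑ s ∈ Finset.range n, v s ω * Real.sign (ζ s ω) with hM
    set A : ℕ → Ω → ℝ := fun n ω ↦ ∑ s ∈ Finset.range n, v s ω ^ 2 with hA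
    have hMm : Measurable[ℱ n] M := by
      refine Finset.measurable_fun_sum _ fun s hs ↦ ?_
      have hsn := Finset.mem_range.1 hs
      exact ((hv s).mono (ℱ.mono hsn.le) le_rfl).mul
        (measurable_sign.comp ((h.adapted_innov s).mono (ℱ.mono hsn) le_rfl))
    have hAm : Measurable[ℱ n] (A (n + 1)) := by
      refine Finset.measurable_fun_sum _ fun s hs ↦ ?_
      exact ((hv s).mono (ℱ.mono (Nat.lt_succ_iff.1 (Finset.mem_range.1 hs))) le_rfl).pow_const 2
    have hMm' : Measurable M := hMm.mono (ℱ.le n) le_rfl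
    have hAm' k : Measurable (A k) := Finset.measurable_fun_sum _ fun s _ ↦ (hvm s).pow_const 2
    set G : Ω → ℂ := fun ω ↦ Complex.exp ((M ω : ℝ) * Complex.I)
      * (Real.exp (A (n + 1) ω / 2) : ℂ) with hG
    have hexpm : Measurable fun p : ℝ × ℝ ↦
        Complex.exp ((p.1 : ℝ) * Complex.I) * (Real.exp (p.2 / 2) : ℂ) := by fun_prop
    have hGm : Measurable[ℱ n] G := hexpm.comp (hMm.prodMk hAm)
    have hGm' : Measurable G := hGm.mono (ℱ.le n) le_rfl
    have hGK ω : ‖G ω‖ ≤ Real.exp (K / 2) := by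
      rw [hG]
      simp only
      rw [norm_mul, Complex.norm_exp_ofReal_mul_I, one_mul, Complex.norm_real, Real.norm_eq_abs,
        Real.abs_exp]
      gcongr
      exact hK (n + 1) ω
    have hAs ω : A (n + 1) ω = A n ω + v n ω ^ 2 := Finset.sum_range_succ _ _
    have hvn := hvm n
    have hζn := hζm n
    have hgapn : Measurable fun ω ↦ cosGap (v n ω) := hgap.comp hvn
    have hint : Integrable
        (fun ω ↦ G ω * Complex.exp ((v n ω * Real.sign (ζ n ω) : ℝ) * Complex.I)) μ := by
      refine Integrable.of_bound (by fun_prop) (Real.exp (K / 2)) (ae_of_all _ fun ω ↦ ?_)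
      rw [norm_mul, Complex.norm_exp_ofReal_mul_I, mul_one]
      exact hGK ω
    -- Integrating out the innovation at time `n` replaces its exponential by a cosine, while the
    -- induction hypothesis has `exp (-v n ^ 2 / 2)` in its place.
    have hstep : ∫ ω, G ω * Complex.exp ((v n ω * Real.sign (ζ n ω) : ℝ) * Complex.I) ∂μ
        = ∫ ω, G ω * (Real.cos (v n ω) : ℂ) ∂μ := by
      have hF : Measurable fun p : (ℂ × ℝ) × ℝ ↦
          p.1.1 * Complex.exp ((p.1.2 * Real.sign p.2 : ℝ) * Complex.I) := by fun_prop
      rw [h.integral_comp_innov (hGm.prodMk (hv n)) hF.stronglyMeasurable hint]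
      simp only [integral_const_mul, hsign]
    have e1 ω : Complex.exp ((∑ s ∈ Finset.range (n + 1), v s ω * Real.sign (ζ s ω) : ℝ)
          * Complex.I) * (Real.exp ((∑ s ∈ Finset.range (n + 1), v s ω ^ 2) / 2) : ℂ)
        = G ω * Complex.exp ((v n ω * Real.sign (ζ n ω) : ℝ) * Complex.I) := by
      rw [Finset.sum_range_succ, Complex.ofReal_add, add_mul, Complex.exp_add]
      simp only [hG, hM, hA]
      ring
    have e2 ω : Complex.exp ((M ω : ℝ) * Complex.I) * (Real.exp (A n ω / 2) : ℂ)
        = G ω * (Real.exp (-(v n ω ^ 2 / 2)) : ℂ) := by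
      rw [hG]
      simp only
      rw [mul_assoc, ← Complex.ofReal_mul, ← Real.exp_add, hAs]
      ring_nf
    simp_rw [e1]
    rw [hstep]
    rw [show (∫ ω, Complex.exp ((M ω : ℝ) * Complex.I) * (Real.exp (A n ω / 2) : ℂ) ∂μ)
      = ∫ ω, G ω * (Real.exp (-(v n ω ^ 2 / 2)) : ℂ) ∂μ from
        integral_congr_ae (ae_of_all _ e2)] at ih
    have k1 : Integrable (fun ω ↦ G ω * (Real.cos (v n ω) : ℂ)) μ := by
      refine Integrable.of_bound (by fun_prop) (Real.exp (K / 2) * 1) (ae_of_all _ fun ω ↦ ?_)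
      rw [norm_mul, Complex.norm_real]
      exact mul_le_mul (hGK ω) (Real.abs_cos_le_one _) (norm_nonneg _) (Real.exp_pos _).le
    have k2 : Integrable (fun ω ↦ G ω * (Real.exp (-(v n ω ^ 2 / 2)) : ℂ)) μ := by
      refine Integrable.of_bound (by fun_prop) (Real.exp (K / 2) * 1) (ae_of_all _ fun ω ↦ ?_)
      rw [norm_mul, Complex.norm_real, Real.norm_eq_abs, Real.abs_exp]
      exact mul_le_mul (hGK ω) (Real.exp_le_one_iff.2 (by nlinarith [sq_nonneg (v n ω)]))
        (Real.exp_pos _).le (Real.exp_pos _).le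
    have hdiff : ‖(∫ ω, G ω * (Real.cos (v n ω) : ℂ) ∂μ)
        - ∫ ω, G ω * (Real.exp (-(v n ω ^ 2 / 2)) : ℂ) ∂μ‖
        ≤ Real.exp (K / 2) * ∫ ω, cosGap (v n ω) ∂μ := by
      rw [← integral_sub k1 k2, ← integral_const_mul]
      refine norm_integral_le_of_norm_le ?_ (ae_of_all _ fun ω ↦ ?_)
      · refine Integrable.of_bound (hgapn.const_mul _).aestronglyMeasurable (Real.exp (K / 2) * 2)
          (ae_of_all _ fun ω ↦ ?_)
        rw [Real.norm_eq_abs, abs_mul, Real.abs_exp, abs_of_nonneg (cosGap_nonneg _)]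
        gcongr
        refine (abs_sub _ _).trans ?_
        rw [Real.abs_exp]
        have := Real.abs_cos_le_one (v n ω)
        have : Real.exp (-(v n ω ^ 2 / 2)) ≤ 1 :=
          Real.exp_le_one_iff.2 (by nlinarith [sq_nonneg (v n ω)])
        linarith
      · rw [← mul_sub, norm_mul, ← Complex.ofReal_sub, Complex.norm_real]
        exact mul_le_mul_of_nonneg_right (hGK ω) (norm_nonneg _)
    rw [Finset.sum_range_succ, mul_add]
    have := norm_add_le ((∫ ω, G ω * (Real.cos (v n ω) : ℂ) ∂μ)
        - ∫ ω, G ω * (Real.exp (-(v n ω ^ 2 / 2)) : ℂ) ∂μ)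
        ((∫ ω, G ω * (Real.exp (-(v n ω ^ 2 / 2)) : ℂ) ∂μ) - 1)
    rw [sub_add_sub_cancel] at this
    linarith

/-- A Lindeberg condition. It follows from a finite second moment alone: the bound by `v ^ 2` gives
domination and the bound by `v ^ 4` the pointwise limit. -/
theorem tendsto_mul_integral_cosGap [IsProbabilityMeasure μ] (h : CausalAR1 μ θ x ζ ℱ) (u : ℝ) :
    Tendsto (fun N : ℕ ↦ N * ∫ ω, cosGap (u * (scale N * x 0 ω)) ∂μ) atTop (𝓝 0) := by
  have hxm := h.measurable 0
  have hgap : Measurable cosGap := continuous_cosGap.measurable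
  have hinv : Tendsto (fun N : ℕ ↦ ((N : ℝ) + 1)⁻¹) atTop (𝓝 0) := by
    simpa using tendsto_one_div_add_atTop_nhds_zero_nat (𝕜 := ℝ)
  simp_rw [← integral_const_mul]
  have hNN (N : ℕ) : (N : ℝ) * ((N : ℝ) + 1)⁻¹ ≤ 1 := by
    rw [← div_eq_mul_inv, div_le_one (by positivity)]; linarith
  have := tendsto_integral_of_dominated_convergence (μ := μ)
    (F := fun (N : ℕ) ω ↦ (N : ℝ) * cosGap (u * (scale N * x 0 ω)))
    (f := fun _ ↦ (0 : ℝ)) (fun ω ↦ u ^ 2 * x 0 ω ^ 2)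
    (fun N ↦ ((hgap.comp (by fun_prop)).const_mul _).aestronglyMeasurable)
    (h.memLp.integrable_sq.const_mul _) ?_ ?_
  · simpa using this
  · refine fun N ↦ ae_of_all _ fun ω ↦ ?_
    rw [Real.norm_eq_abs, abs_of_nonneg (mul_nonneg (Nat.cast_nonneg _) (cosGap_nonneg _))]
    calc (N : ℝ) * cosGap (u * (scale N * x 0 ω))
        ≤ N * (u * (scale N * x 0 ω)) ^ 2 := by gcongr; exact cosGap_le_sq _
      _ = (N * ((N : ℝ) + 1)⁻¹) * (u ^ 2 * x 0 ω ^ 2) := by rw [← scale_sq]; ring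
      _ ≤ 1 * (u ^ 2 * x 0 ω ^ 2) := by gcongr; exact hNN N
      _ = _ := one_mul _
  · refine ae_of_all _ fun ω ↦ ?_
    have h0 : Tendsto (fun N : ℕ ↦ u * (scale N * x 0 ω)) atTop (𝓝 0) := by
      simpa using (tendsto_scale.mul_const (x 0 ω)).const_mul u
    have hev : ∀ᶠ N : ℕ in atTop, |u * (scale N * x 0 ω)| ≤ 1 :=
      (by simpa using h0.abs : Tendsto _ _ (𝓝 (0 : ℝ))).eventually_le_const one_pos
    have hlim : Tendsto (fun N : ℕ ↦ ((N : ℝ) + 1)⁻¹ * (u * x 0 ω) ^ 4) atTop (𝓝 0) := by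
      simpa using hinv.mul_const ((u * x 0 ω) ^ 4)
    refine squeeze_zero' (Eventually.of_forall fun N ↦
      mul_nonneg (Nat.cast_nonneg _) (cosGap_nonneg _)) ?_ hlim
    filter_upwards [hev] with N hN
    calc (N : ℝ) * cosGap (u * (scale N * x 0 ω))
        ≤ N * (u * (scale N * x 0 ω)) ^ 4 := by
          gcongr; exact cosGap_le_pow_four hN
      _ = (N * scale N ^ 2) * (scale N ^ 2 * (u * x 0 ω) ^ 4) := by ring
      _ = (N * ((N : ℝ) + 1)⁻¹) * (((N : ℝ) + 1)⁻¹ * (u * x 0 ω) ^ 4) := by rw [scale_sq]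
      _ ≤ 1 * (((N : ℝ) + 1)⁻¹ * (u * x 0 ω) ^ 4) := by gcongr; exact hNN N
      _ = _ := one_mul _

end CausalAR1
end LADAR1

/-! ### The central limit theorem for the sign score -/

namespace LADAR1
open scoped Topology

/-- The coefficient `scale N * x s`, replaced by zero as soon as the normalized sum of squares up to
and including time `s` exceeds `L`. It depends on `x 0, …, x s` only, so it is known before `ζ s`. -/
noncomputable def truncatedCoeff {Ω : Type*} (x : ℕ → Ω → ℝ) (L : ℝ) (N s : ℕ) (ω : Ω) : ℝ :=
  if ((N : ℝ) + 1)⁻¹ * ∑ r ∈ Finset.range (s + 1), x r ω ^ 2 ≤ L then scale N * x s ω else 0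

theorem sum_truncatedCoeff_sq_le {Ω : Type*} (x : ℕ → Ω → ℝ) {L : ℝ} (hL : 0 ≤ L) (N n : ℕ)
    (ω : Ω) : ∑ s ∈ Finset.range n, truncatedCoeff x L N s ω ^ 2 ≤ L := by
  have h1 (n : ℕ) : ∑ s ∈ Finset.range n, truncatedCoeff x L N s ω ^ 2
      ≤ ((N : ℝ) + 1)⁻¹ * ∑ s ∈ Finset.range n, x s ω ^ 2 := by
    rw [Finset.mul_sum]
    refine Finset.sum_le_sum fun s _ ↦ ?_
    unfold truncatedCoeff
    split_ifs
    · rw [mul_pow, scale_sq]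
    · rw [zero_pow two_ne_zero]; positivity
  induction n with
  | zero => simpa using hL
  | succ n ih =>
    by_cases hn : ((N : ℝ) + 1)⁻¹ * ∑ r ∈ Finset.range (n + 1), x r ω ^ 2 ≤ L
    · exact (h1 _).trans hn
    · rw [Finset.sum_range_succ, truncatedCoeff, if_neg hn]
      simpa using ih

theorem truncatedCoeff_eq {Ω : Type*} (x : ℕ → Ω → ℝ) {L : ℝ} {N s : ℕ} {ω : Ω} (hs : s < N)
    (hL : ((N : ℝ) + 1)⁻¹ * ∑ r ∈ Finset.range N, x r ω ^ 2 ≤ L) :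
    truncatedCoeff x L N s ω = scale N * x s ω := by
  refine if_pos (le_trans ?_ hL)
  gcongr
  exact hs

theorem norm_exp_mul_I_sub_le (a b : ℝ) :
    ‖Complex.exp ((a : ℝ) * Complex.I) - Complex.exp ((b : ℝ) * Complex.I)‖ ≤ 2 := by
  refine (norm_sub_le _ _).trans ?_
  rw [Complex.norm_exp_ofReal_mul_I, Complex.norm_exp_ofReal_mul_I]
  norm_num

variable {Ω : Type*} [mΩ : MeasurableSpace Ω] {μ : Measure Ω} {θ : ℝ}

namespace CausalAR1

variable {x ζ : ℕ → Ω → ℝ} {ℱ : Filtration ℕ mΩ}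

theorem measurable_truncatedCoeff (h : CausalAR1 μ θ x ζ ℱ) (L : ℝ) (N s : ℕ) :
    Measurable[ℱ s] (truncatedCoeff x L N s) := by
  have hsum : Measurable[ℱ s]
      fun ω ↦ ((N : ℝ) + 1)⁻¹ * ∑ r ∈ Finset.range (s + 1), x r ω ^ 2 := by
    refine Measurable.const_mul (Finset.measurable_fun_sum _ fun r hr ↦ ?_) _
    exact ((h.adapted r).mono (ℱ.mono (Nat.lt_succ_iff.1 (Finset.mem_range.1 hr))) le_rfl).pow_const 2
  exact Measurable.ite (hsum measurableSet_Iic) ((h.adapted s).const_mul _) measurable_const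

/-- The normalized sum `(N + 1) ^ (-1/2) * ∑ s < N, x s * sign (ζ s)`: the sample of size `N + 1`
has `N` innovations. -/
noncomputable def signScore (x ζ : ℕ → Ω → ℝ) (N : ℕ) (ω : Ω) : ℝ :=
  scale N * ∑ s ∈ Finset.range N, x s ω * Real.sign (ζ s ω)

theorem measurable_signScore (h : CausalAR1 μ θ x ζ ℱ) (N : ℕ) : Measurable (signScore x ζ N) := by
  have := h.measurable
  have := h.measurable_innov
  unfold signScore
  fun_prop

/-- A quantitative form of the martingale central limit theorem for `signScore`. The coefficients
are truncated once the quadratic variation exceeds its limit by one, which costs no more than the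
law of large numbers allows. -/
theorem norm_charFun_signScore_sub_le [IsProbabilityMeasure μ] (h : CausalAR1 μ θ x ζ ℱ)
    (hsign : ∀ a : ℝ, ∫ z, Complex.exp ((a * Real.sign z : ℝ) * Complex.I) ∂(μ.map (ζ 0))
      = Real.cos a) {v : ℝ} (hv0 : 0 ≤ v) (u : ℝ) (N : ℕ) :
    ‖(∫ ω, Complex.exp ((u * signScore x ζ N ω : ℝ) * Complex.I) ∂μ)
        - (Real.exp (-(u ^ 2 * v / 2)) : ℂ)‖
      ≤ (2 + Real.exp (u ^ 2 / 2) * (u ^ 2 / 2 * (v + 2)))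
          * ∫ ω, |((N : ℝ) + 1)⁻¹ * ∑ s ∈ Finset.range N, x s ω ^ 2 - v| ∂μ
        + Real.exp (u ^ 2 / 2) * (N * ∫ ω, cosGap (u * (scale N * x 0 ω)) ∂μ) := by
  have hxm := h.measurable
  have hζm := h.measurable_innov
  have hgap : Measurable cosGap := continuous_cosGap.measurable
  set V : Ω → ℝ := fun ω ↦ ((N : ℝ) + 1)⁻¹ * ∑ s ∈ Finset.range N, x s ω ^ 2 with hV
  have hVm : Measurable V := by fun_prop
  set a : ℕ → Ω → ℝ := truncatedCoeff x (v + 1) N with ha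
  have ham s : Measurable (a s) := (h.measurable_truncatedCoeff (v + 1) N s).mono (ℱ.le s) le_rfl
  set A : Ω → ℝ := fun ω ↦ ∑ s ∈ Finset.range N, a s ω ^ 2 with hA
  have hAm : Measurable A := by fun_prop
  set M : Ω → ℝ := fun ω ↦ ∑ s ∈ Finset.range N, a s ω * Real.sign (ζ s ω) with hM
  have hMm : Measurable M := by fun_prop
  have hWm := h.measurable_signScore N
  have hA0 ω : 0 ≤ A ω := Finset.sum_nonneg fun s _ ↦ sq_nonneg _
  have hA1 ω : A ω ≤ v + 1 := sum_truncatedCoeff_sq_le x (by linarith) N N ω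
  -- On the event where the quadratic variation stays below `v + 1` nothing is truncated.
  have hgood ω (hω : V ω ≤ v + 1) : M ω = signScore x ζ N ω ∧ A ω = V ω := by
    constructor
    · rw [signScore, Finset.mul_sum]
      refine Finset.sum_congr rfl fun s hs ↦ ?_
      rw [ha, truncatedCoeff_eq x (Finset.mem_range.1 hs) hω, mul_assoc]
    · rw [hV]
      simp only
      rw [Finset.mul_sum]
      refine Finset.sum_congr rfl fun s hs ↦ ?_
      rw [ha, truncatedCoeff_eq x (Finset.mem_range.1 hs) hω, mul_pow, scale_sq]
  -- Off that event `|V - v|` exceeds one, so it dominates every bounded error.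
  have hAV ω : |A ω - v| ≤ (v + 2) * |V ω - v| := by
    by_cases hω : V ω ≤ v + 1
    · rw [(hgood ω hω).2]
      exact le_mul_of_one_le_left (abs_nonneg _) (by linarith)
    · have h1 : 1 ≤ |V ω - v| := by
        rw [not_le] at hω
        exact le_trans (by linarith) (le_abs_self _)
      have h2 : |A ω - v| ≤ v + 1 := abs_le.2 ⟨by linarith [hA0 ω], by linarith [hA1 ω]⟩
      nlinarith
  have hWM ω : ‖Complex.exp ((u * signScore x ζ N ω : ℝ) * Complex.I)
      - Complex.exp ((u * M ω : ℝ) * Complex.I)‖ ≤ 2 * |V ω - v| := by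
    by_cases hω : V ω ≤ v + 1
    · rw [(hgood ω hω).1, sub_self, norm_zero]
      positivity
    · rw [not_le] at hω
      have h1 : 1 ≤ |V ω - v| := le_trans (by linarith) (le_abs_self _)
      exact (norm_exp_mul_I_sub_le _ _).trans (by linarith)
  -- `E * Y` below is the exponential of the truncated martingale, with an expectation near `E`.
  have hcomp := h.norm_integral_compensated_exp_sub_one_le hsign
    (v := fun s ω ↦ u * a s ω) (K := u ^ 2 * (v + 1))
    (fun s ↦ (h.measurable_truncatedCoeff (v + 1) N s).const_mul u) (fun n ω ↦ by
      simp_rw [mul_pow]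
      rw [← Finset.mul_sum]
      gcongr
      exact sum_truncatedCoeff_sq_le x (by linarith) N n ω) N
  have e1 ω : ∑ s ∈ Finset.range N, u * a s ω * Real.sign (ζ s ω) = u * M ω := by
    rw [hM]
    simp only
    rw [Finset.mul_sum]
    exact Finset.sum_congr rfl fun s _ ↦ mul_assoc _ _ _
  have e2 ω : ∑ s ∈ Finset.range N, (u * a s ω) ^ 2 = u ^ 2 * A ω := by
    simp_rw [mul_pow]
    rw [← Finset.mul_sum]
  simp_rw [e1, e2] at hcomp
  set Y : Ω → ℂ := fun ω ↦ Complex.exp ((u * M ω : ℝ) * Complex.I)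
    * (Real.exp (u ^ 2 * A ω / 2) : ℂ) with hY
  have hgapint (t : ℕ) : Integrable (fun ω ↦ cosGap (u * (scale N * x t ω))) μ := by
    refine Integrable.mono' ((h.memLp_x t).integrable_sq.const_mul (u ^ 2 * scale N ^ 2))
      (hgap.comp (by fun_prop)).aestronglyMeasurable (ae_of_all _ fun ω ↦ ?_)
    rw [Real.norm_eq_abs, abs_of_nonneg (cosGap_nonneg _)]
    refine (cosGap_le_sq _).trans_eq (by ring)
  have hsumgap : ∑ s ∈ Finset.range N, ∫ ω, cosGap (u * a s ω) ∂μ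
      ≤ N * ∫ ω, cosGap (u * (scale N * x 0 ω)) ∂μ := by
    have hle (s : ℕ) : ∫ ω, cosGap (u * a s ω) ∂μ ≤ ∫ ω, cosGap (u * (scale N * x 0 ω)) ∂μ := by
      have hid : ∫ ω, cosGap (u * (scale N * x s ω)) ∂μ = ∫ ω, cosGap (u * (scale N * x 0 ω)) ∂μ :=
        ((h.ident s).comp (u := fun y ↦ cosGap (u * (scale N * y)))
          (hgap.comp (by fun_prop))).integral_eq
      rw [← hid]
      refine integral_mono_of_nonneg (ae_of_all _ fun ω ↦ cosGap_nonneg _) (hgapint s)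
        (ae_of_all _ fun ω ↦ ?_)
      simp only [ha, truncatedCoeff]
      split_ifs
      · exact le_rfl
      · rw [mul_zero, cosGap_zero]; exact cosGap_nonneg _
    refine (Finset.sum_le_sum fun s _ ↦ hle s).trans_eq ?_
    simp
  have hYm : Measurable Y := by fun_prop
  have hYint : Integrable Y μ := by
    refine Integrable.of_bound hYm.aestronglyMeasurable (Real.exp (u ^ 2 * (v + 1) / 2))
      (ae_of_all _ fun ω ↦ ?_)
    rw [hY]
    simp only
    rw [norm_mul, Complex.norm_exp_ofReal_mul_I, one_mul, Complex.norm_real, Real.norm_eq_abs,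
      Real.abs_exp]
    gcongr
    exact hA1 ω
  have hVint : Integrable (fun ω ↦ |V ω - v|) μ := by
    refine Integrable.abs (Integrable.sub (Integrable.const_mul ?_ _) (integrable_const v))
    exact integrable_finsetSum _ fun s _ ↦ (h.memLp_x s).integrable_sq
  set E : ℂ := (Real.exp (-(u ^ 2 * v / 2)) : ℂ) with hE
  have hWint : Integrable (fun ω ↦ Complex.exp ((u * signScore x ζ N ω : ℝ) * Complex.I)) μ :=
    Integrable.of_bound (by fun_prop) 1 (ae_of_all _ fun ω ↦ by
      rw [Complex.norm_exp_ofReal_mul_I])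
  -- replacing the score by its compensated truncated version
  have hpt ω : ‖Complex.exp ((u * signScore x ζ N ω : ℝ) * Complex.I) - E * Y ω‖
      ≤ (2 + Real.exp (u ^ 2 / 2) * (u ^ 2 / 2 * (v + 2))) * |V ω - v| := by
    have hEY : E * Y ω = Complex.exp ((u * M ω : ℝ) * Complex.I)
        * (Real.exp (u ^ 2 * (A ω - v) / 2) : ℂ) := by
      rw [hE, hY]
      simp only
      rw [mul_left_comm, ← Complex.ofReal_mul, ← Real.exp_add]
      ring_nf
    have hsplit : Complex.exp ((u * signScore x ζ N ω : ℝ) * Complex.I) - E * Y ω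
        = (Complex.exp ((u * signScore x ζ N ω : ℝ) * Complex.I)
            - Complex.exp ((u * M ω : ℝ) * Complex.I))
          + Complex.exp ((u * M ω : ℝ) * Complex.I)
            * ((1 - Real.exp (u ^ 2 * (A ω - v) / 2) : ℝ) : ℂ) := by
      rw [hEY]; push_cast; ring
    have hb : |1 - Real.exp (u ^ 2 * (A ω - v) / 2)|
        ≤ Real.exp (u ^ 2 / 2) * (u ^ 2 / 2 * (v + 2)) * |V ω - v| := by
      refine (abs_one_sub_exp_le (b := u ^ 2 / 2) (by positivity) ?_).trans ?_
      · nlinarith [sq_nonneg u, hA1 ω]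
      · rw [mul_assoc]
        gcongr
        rw [mul_div_right_comm, abs_mul, abs_of_nonneg (by positivity : 0 ≤ u ^ 2 / 2), mul_assoc]
        gcongr
        exact hAV ω
    rw [hsplit, add_mul]
    refine (norm_add_le _ _).trans (add_le_add (hWM ω) ?_)
    rw [norm_mul, Complex.norm_exp_ofReal_mul_I, one_mul, Complex.norm_real]
    exact hb
  have h1 : ‖(∫ ω, Complex.exp ((u * signScore x ζ N ω : ℝ) * Complex.I) ∂μ) - E * ∫ ω, Y ω ∂μ‖
      ≤ (2 + Real.exp (u ^ 2 / 2) * (u ^ 2 / 2 * (v + 2))) * ∫ ω, |V ω - v| ∂μ := by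
    rw [← integral_const_mul, ← integral_const_mul, ← integral_sub hWint (hYint.const_mul E)]
    exact norm_integral_le_of_norm_le (hVint.const_mul _) (ae_of_all _ hpt)
  have h2 : ‖E * ∫ ω, Y ω ∂μ - E‖
      ≤ Real.exp (u ^ 2 / 2) * (N * ∫ ω, cosGap (u * (scale N * x 0 ω)) ∂μ) := by
    rw [← mul_sub_one, norm_mul, hE, Complex.norm_real, Real.norm_eq_abs, Real.abs_exp]
    calc Real.exp (-(u ^ 2 * v / 2)) * ‖(∫ ω, Y ω ∂μ) - 1‖
        ≤ Real.exp (-(u ^ 2 * v / 2)) * (Real.exp (u ^ 2 * (v + 1) / 2)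
            * ∑ s ∈ Finset.range N, ∫ ω, cosGap (u * a s ω) ∂μ) := by gcongr
      _ = Real.exp (u ^ 2 / 2) * ∑ s ∈ Finset.range N, ∫ ω, cosGap (u * a s ω) ∂μ := by
          rw [← mul_assoc, ← Real.exp_add]
          ring_nf
      _ ≤ _ := by gcongr
  calc _ = ‖((∫ ω, Complex.exp ((u * signScore x ζ N ω : ℝ) * Complex.I) ∂μ) - E * ∫ ω, Y ω ∂μ)
        + (E * ∫ ω, Y ω ∂μ - E)‖ := by rw [sub_add_sub_cancel]
    _ ≤ _ := (norm_add_le _ _).trans (add_le_add h1 h2)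

/-- The martingale central limit theorem for `signScore`. -/
theorem tendstoInDistribution_signScore [IsProbabilityMeasure μ] (h : CausalAR1 μ θ x ζ ℱ)
    (hsign : ∀ a : ℝ, ∫ z, Complex.exp ((a * Real.sign z : ℝ) * Complex.I) ∂(μ.map (ζ 0))
      = Real.cos a) :
    TendstoInDistribution (signScore x ζ) atTop (id : ℝ → ℝ) (fun _ ↦ μ)
      (gaussianReal 0 (∫ ω, x 0 ω ^ 2 ∂μ).toNNReal) where
  forall_aemeasurable N := (h.measurable_signScore N).aemeasurable
  aemeasurable_limit := aemeasurable_id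
  tendsto := by
    refine ProbabilityMeasure.tendsto_iff_tendsto_charFun.2 fun u ↦ ?_
    rw! [Measure.map_id]
    simp only [ProbabilityMeasure.coe_mk]
    have hv0 : 0 ≤ ∫ ω, x 0 ω ^ 2 ∂μ := integral_nonneg fun ω ↦ sq_nonneg _
    set v := ∫ ω, x 0 ω ^ 2 ∂μ with hv
    have hlimit : charFun (gaussianReal 0 v.toNNReal) u = (Real.exp (-(u ^ 2 * v / 2)) : ℂ) := by
      rw [charFun_gaussianReal, Real.coe_toNNReal _ hv0]
      push_cast
      ring_nf
    have hpre N : charFun (μ.map (signScore x ζ N)) u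
        = ∫ ω, Complex.exp ((u * signScore x ζ N ω : ℝ) * Complex.I) ∂μ := by
      rw [charFun_apply_real, integral_map (h.measurable_signScore N).aemeasurable
        (Measurable.aestronglyMeasurable (by fun_prop))]
      push_cast
      rfl
    rw [hlimit, tendsto_iff_norm_sub_tendsto_zero]
    simp_rw [hpre]
    have hbound := fun N ↦ h.norm_charFun_signScore_sub_le hsign hv0 u N
    refine squeeze_zero (fun N ↦ norm_nonneg _) hbound ?_
    have := (h.tendsto_integral_abs_sq.const_mul
      (2 + Real.exp (u ^ 2 / 2) * (u ^ 2 / 2 * (v + 2)))).add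
      ((h.tendsto_mul_integral_cosGap u).const_mul (Real.exp (u ^ 2 / 2)))
    simpa only [mul_zero, add_zero] using this

end CausalAR1
end LADAR1

/-! ### Asymptotic linearity of the local score -/

namespace LADAR1
open scoped Topology

/-- The expected sign of an error with law `ν`, recentred at `y`. -/
noncomputable def signMean (ν : Measure ℝ) (y : ℝ) : ℝ := ∫ z, Real.sign (z - y) ∂ν

theorem integrable_sign_sub (ν : Measure ℝ) [IsProbabilityMeasure ν] (y : ℝ) :
    Integrable (fun z ↦ Real.sign (z - y)) ν :=
  Integrable.of_bound (Measurable.aestronglyMeasurable (by fun_prop)) 1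
    (ae_of_all _ fun _ ↦ abs_sign_le_one _)

theorem abs_signMean_le_one (ν : Measure ℝ) [IsProbabilityMeasure ν] (y : ℝ) :
    |signMean ν y| ≤ 1 := by
  have := norm_integral_le_of_norm_le_const (μ := ν) (f := fun z ↦ Real.sign (z - y)) (C := 1)
    (ae_of_all _ fun z ↦ abs_sign_le_one (z - y))
  simpa [signMean] using this

theorem signMean_eq (ν : Measure ℝ) [IsProbabilityMeasure ν] [NullSingletonClass ν] (y : ℝ) :
    signMean ν y = 1 - 2 * cdf ν y := by
  have e : (fun z ↦ Real.sign (z - y)) =ᵐ[ν] fun z ↦ 1 - 2 * (Set.Iic y).indicator 1 z := by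
    filter_upwards [ν.ae_ne y] with z hz
    rcases lt_or_gt_of_ne hz with hz | hz
    · rw [Real.sign_of_neg (by linarith), Set.indicator_of_mem (Set.mem_Iic.2 hz.le)]; norm_num
    · rw [Real.sign_of_pos (by linarith), Set.indicator_of_notMem (by simpa using hz)]; norm_num
  have hi : Integrable (fun z ↦ 2 * (Set.Iic y).indicator (1 : ℝ → ℝ) z) ν :=
    ((integrable_const (1 : ℝ)).indicator measurableSet_Iic).const_mul _
  rw [signMean, integral_congr_ae e, integral_sub (integrable_const _) hi, integral_const_mul,
    integral_indicator_one measurableSet_Iic, cdf_eq_real]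
  simp

theorem measurable_signMean (ν : Measure ℝ) [IsProbabilityMeasure ν] : Measurable (signMean ν) := by
  have : Measurable fun p : ℝ × ℝ ↦ Real.sign (p.2 - p.1) := by fun_prop
  exact this.stronglyMeasurable.integral_prod_right'.measurable

theorem cdf_zero_of_isMedian {ν : Measure ℝ} [IsProbabilityMeasure ν] [NullSingletonClass ν]
    (hν : IsMedian ν 0) : cdf ν 0 = 1 / 2 := by
  have h1 : ν.real (Set.Ici 0) = 1 - ν.real (Set.Iic 0) := by
    rw [← probReal_compl_eq_one_sub measurableSet_Iic, Set.compl_Iic]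
    exact measureReal_congr Ioi_ae_eq_Ici.symm
  have := hν.1
  have := hν.2
  rw [cdf_eq_real]
  linarith

/-- A sign whose two values are equally likely has characteristic function `cos`. -/
theorem integral_exp_sign {ν : Measure ℝ} [IsProbabilityMeasure ν] [NullSingletonClass ν]
    (hν : IsMedian ν 0) (a : ℝ) :
    ∫ z, Complex.exp ((a * Real.sign z : ℝ) * Complex.I) ∂ν = Real.cos a := by
  have e : (fun z ↦ Complex.exp ((a * Real.sign z : ℝ) * Complex.I)) =ᵐ[ν]
      fun z ↦ (Real.cos a : ℂ) + (Real.sign z : ℂ) * (Real.sin a * Complex.I) := by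
    filter_upwards [ν.ae_ne 0] with z hz
    rcases lt_or_gt_of_ne hz with hz | hz
    · rw [Real.sign_of_neg hz, Complex.exp_mul_I]
      simp
    · rw [Real.sign_of_pos hz, Complex.exp_mul_I]
      simp
  have h0 : ∫ z, (Real.sign z : ℂ) ∂ν = 0 := by
    have h1 := signMean_eq ν 0
    rw [cdf_zero_of_isMedian hν] at h1
    simp only [signMean, sub_zero] at h1
    have h2 : ∫ z, (Real.sign z : ℂ) ∂ν = ((∫ z, Real.sign z ∂ν : ℝ) : ℂ) := integral_ofReal
    rw [h2, h1]
    norm_num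
  have hint : Integrable (fun z ↦ (Real.sign z : ℂ)) ν := by
    have := (integrable_sign_sub ν 0).ofReal (𝕜 := ℂ)
    simpa using this
  rw [integral_congr_ae e, integral_add (integrable_const _) (hint.mul_const _),
    integral_mul_const, h0]
  simp

/-- The relative error of the linear approximation `-2 * d * y` of `signMean ν y`; it is `0` at
`y = 0` because of the division by zero. -/
noncomputable def signMeanErr (ν : Measure ℝ) (d y : ℝ) : ℝ := |signMean ν y + 2 * d * y| / |y|

theorem measurable_signMeanErr (ν : Measure ℝ) [IsProbabilityMeasure ν] (d : ℝ) :
    Measurable (signMeanErr ν d) := by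
  have := measurable_signMean ν
  unfold signMeanErr
  fun_prop

theorem signMeanErr_nonneg (ν : Measure ℝ) (d y : ℝ) : 0 ≤ signMeanErr ν d y := by
  unfold signMeanErr; positivity

theorem signMean_zero {ν : Measure ℝ} [IsProbabilityMeasure ν] [NullSingletonClass ν]
    (hν : IsMedian ν 0) : signMean ν 0 = 0 := by
  rw [signMean_eq, cdf_zero_of_isMedian hν]; norm_num

theorem abs_signMean_add {ν : Measure ℝ} [IsProbabilityMeasure ν] [NullSingletonClass ν]
    (hν : IsMedian ν 0) (d y : ℝ) :
    |signMean ν y + 2 * d * y| = |y| * signMeanErr ν d y := by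
  rcases eq_or_ne y 0 with rfl | hy
  · simp [signMean_zero hν]
  · rw [signMeanErr, mul_div_cancel₀ _ (abs_ne_zero.2 hy)]

/-- The local expansion makes the relative error small near zero; away from zero it is bounded
because `signMean` is. -/
theorem exists_signMeanErr_le {ν : Measure ℝ} [IsProbabilityMeasure ν] [NullSingletonClass ν]
    (hν : IsMedian ν 0) {f : ℝ → ℝ} (hF : LocalExpansionAtZero (cdf ν) f) :
    (∃ B, ∀ y, signMeanErr ν (f 0) y ≤ B) ∧ Tendsto (signMeanErr ν (f 0)) (𝓝 0) (𝓝 0) := by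
  obtain ⟨c, hc, α, hα, M, hM, hF⟩ := hF
  have hsmall y (hy : |y| ≤ M) : signMeanErr ν (f 0) y ≤ 2 * c * |y| ^ α := by
    rcases eq_or_ne y 0 with rfl | hy0
    · simp only [signMeanErr, abs_zero, div_zero]; positivity
    have hy0' : 0 < |y| := abs_pos.2 hy0
    have h1 := hF y hy
    rw [Real.rpow_add hy0', Real.rpow_one] at h1
    have h2 : signMean ν y + 2 * f 0 * y = -2 * (cdf ν y - cdf ν 0 - y * f 0) := by
      rw [signMean_eq, cdf_zero_of_isMedian hν]; ring
    rw [signMeanErr, div_le_iff₀ hy0', h2, abs_mul]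
    norm_num
    linarith
  refine ⟨⟨max (2 * c * M ^ α) (1 / M + 2 * |f 0|), fun y ↦ ?_⟩, ?_⟩
  · rcases le_or_gt |y| M with hy | hy
    · refine (hsmall y hy).trans (le_max_of_le_left ?_)
      gcongr
    · refine le_max_of_le_right ?_
      have hy0 : 0 < |y| := hM.trans hy
      have h1 : 1 ≤ 1 / M * |y| := by rw [one_div, ← div_eq_inv_mul, one_le_div hM]; exact hy.le
      rw [signMeanErr, div_le_iff₀ hy0]
      refine (abs_add_le _ _).trans ?_
      rw [abs_mul, abs_mul, abs_two]
      linarith [abs_signMean_le_one ν y]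
  · have hlim : Tendsto (fun y : ℝ ↦ 2 * c * |y| ^ α) (𝓝 0) (𝓝 0) := by
      have : Continuous fun y : ℝ ↦ 2 * c * |y| ^ α :=
        continuous_const.mul (continuous_abs.rpow_const fun _ ↦ Or.inr hα.le)
      simpa [Real.zero_rpow hα.ne'] using this.tendsto 0
    have hnhds : ∀ᶠ y : ℝ in 𝓝 0, |y| ≤ M := by
      have : Tendsto (fun y : ℝ ↦ |y|) (𝓝 0) (𝓝 0) := by simpa using continuous_abs.tendsto (0 : ℝ)
      exact this.eventually_le_const hM
    exact squeeze_zero' (Eventually.of_forall fun y ↦ signMeanErr_nonneg _ _ _)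
      (hnhds.mono hsmall) hlim

theorem tendsto_signMean {ν : Measure ℝ} [IsProbabilityMeasure ν] [NullSingletonClass ν]
    (hν : IsMedian ν 0) {f : ℝ → ℝ} (hF : LocalExpansionAtZero (cdf ν) f) :
    Tendsto (signMean ν) (𝓝 0) (𝓝 0) := by
  have h1 : Tendsto (fun y : ℝ ↦ signMean ν y + 2 * f 0 * y) (𝓝 0) (𝓝 0) := by
    rw [tendsto_zero_iff_norm_tendsto_zero]
    simp only [Real.norm_eq_abs, abs_signMean_add hν]
    have : Tendsto (fun y : ℝ ↦ |y|) (𝓝 0) (𝓝 0) := by simpa using continuous_abs.tendsto (0 : ℝ)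
    simpa using this.mul (exists_signMeanErr_le hν hF).2
  have h2 : Tendsto (fun y : ℝ ↦ 2 * f 0 * y) (𝓝 0) (𝓝 0) := by
    simpa using (continuous_const_mul (2 * f 0)).tendsto (0 : ℝ)
  simpa using h1.sub h2

theorem tendsto_sign_sub {z : ℝ} (hz : z ≠ 0) :
    Tendsto (fun y ↦ Real.sign (z - y)) (𝓝 0) (𝓝 (Real.sign z)) := by
  have hlim : Tendsto (fun y : ℝ ↦ z - y) (𝓝 0) (𝓝 z) := by
    have : Continuous fun y : ℝ ↦ z - y := by fun_prop
    simpa using this.tendsto 0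
  refine tendsto_const_nhds.congr' ?_
  rcases lt_or_gt_of_ne hz with hz | hz
  · filter_upwards [hlim.eventually_lt_const hz] with y hy
    rw [Real.sign_of_neg hz, Real.sign_of_neg hy]
  · filter_upwards [hlim.eventually_const_lt hz] with y hy
    rw [Real.sign_of_pos hz, Real.sign_of_pos hy]

variable {Ω : Type*} [mΩ : MeasurableSpace Ω] {μ : Measure Ω} {θ : ℝ}

/-- Minus the slope at `θ + scale N * a` of the (rescaled) least absolute deviations criterion. -/
noncomputable def ladScore (x ζ : ℕ → Ω → ℝ) (a : ℝ) (N : ℕ) (ω : Ω) : ℝ :=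
  scale N * ∑ s ∈ Finset.range N, x s ω * Real.sign (ζ s ω - a * (scale N * x s ω))

namespace CausalAR1

variable {x ζ : ℕ → Ω → ℝ} {ℱ : Filtration ℕ mΩ}

theorem measurable_ladScore (h : CausalAR1 μ θ x ζ ℱ) (a : ℝ) (N : ℕ) :
    Measurable (ladScore x ζ a N) := by
  have := h.measurable
  have := h.measurable_innov
  unfold ladScore
  fun_prop

/-- A uniformly bounded weight that vanishes in the limit makes the weighted second moment
vanish. -/
theorem tendsto_integral_sq_mul (h : CausalAR1 μ θ x ζ ℱ) {w : ℕ → Ω → ℝ}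
    (hw : ∀ N, Measurable (w N)) {B : ℝ} (hB : ∀ N ω, |w N ω| ≤ B)
    (hlim : ∀ᵐ ω ∂μ, Tendsto (fun N ↦ w N ω) atTop (𝓝 0)) :
    Tendsto (fun N ↦ ∫ ω, x 0 ω ^ 2 * w N ω ∂μ) atTop (𝓝 0) := by
  have hxm := h.measurable 0
  have := tendsto_integral_of_dominated_convergence (μ := μ)
    (F := fun (N : ℕ) ω ↦ x 0 ω ^ 2 * w N ω) (f := fun _ ↦ (0 : ℝ)) (fun ω ↦ x 0 ω ^ 2 * B)
    (fun N ↦ Measurable.aestronglyMeasurable (by have := hw N; fun_prop))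
    (h.memLp.integrable_sq.mul_const B) ?_ ?_
  · simpa using this
  · refine fun N ↦ ae_of_all _ fun ω ↦ ?_
    rw [Real.norm_eq_abs, abs_mul, abs_of_nonneg (sq_nonneg _)]
    gcongr
    exact hB N ω
  · filter_upwards [hlim] with ω hω
    simpa using hω.const_mul (x 0 ω ^ 2)

theorem tendsto_scale_mul (a y : ℝ) : Tendsto (fun N ↦ a * (scale N * y)) atTop (𝓝 0) := by
  simpa using (tendsto_scale.mul_const y).const_mul a

/-- The martingale part of the increment of the score is negligible. -/
theorem tendsto_integral_abs_martingale [IsProbabilityMeasure μ] (h : CausalAR1 μ θ x ζ ℱ)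
    [NullSingletonClass (μ.map (ζ 0))] (hmed : IsMedian (μ.map (ζ 0)) 0) {f : ℝ → ℝ}
    (hF : LocalExpansionAtZero (cdf (μ.map (ζ 0))) f) (a : ℝ) :
    Tendsto (fun N ↦ ∫ ω, |scale N * ∑ s ∈ Finset.range N, x s ω *
      (Real.sign (ζ s ω - a * (scale N * x s ω)) - Real.sign (ζ s ω)
        - signMean (μ.map (ζ 0)) (a * (scale N * x s ω)))| ∂μ) atTop (𝓝 0) := by
  have hxm := h.measurable
  have hζm := h.measurable_innov
  set ν := μ.map (ζ 0) with hν
  have : IsProbabilityMeasure ν := Measure.isProbabilityMeasure_map (hζm 0).aemeasurable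
  have hg := measurable_signMean ν
  set D : ℕ → ℝ × ℝ → ℝ := fun N p ↦ Real.sign (p.2 - a * (scale N * p.1)) - Real.sign p.2
    - signMean ν (a * (scale N * p.1)) with hD
  have hDm N : Measurable (D N) := by fun_prop
  have hD3 N p : |D N p| ≤ 3 := by
    have h1 := abs_le.1 (abs_sign_le_one (p.2 - a * (scale N * p.1)))
    have h2 := abs_le.1 (abs_sign_le_one p.2)
    have h3 := abs_le.1 (abs_signMean_le_one ν (a * (scale N * p.1)))
    rw [hD, abs_le]
    constructor <;> simp only <;> linarith [h1.1, h1.2, h2.1, h2.2, h3.1, h3.2]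
  have hD0 N b : ∫ z, D N (b, z) ∂ν = 0 := by
    have i1 := integrable_sign_sub ν (a * (scale N * b))
    have i2 : Integrable Real.sign ν := by simpa using integrable_sign_sub ν 0
    have h0 : ∫ z, Real.sign z ∂ν = 0 := by simpa [signMean] using signMean_zero hmed
    simp only [hD]
    rw [integral_sub (f := fun z ↦ Real.sign (z - a * (scale N * b)) - Real.sign z) (i1.sub i2)
      (integrable_const _), integral_sub i1 i2, h0]
    simp [signMean]
  have hDpm N : Measurable fun ω ↦ D N (x 0 ω, ζ 0 ω) := (hDm N).comp ((hxm 0).prodMk (hζm 0))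
  have hne : ∀ᵐ ω ∂μ, ζ 0 ω ≠ 0 :=
    ae_of_ae_map (hζm 0).aemeasurable (p := fun z ↦ z ≠ 0) (ν.ae_ne 0)
  have hsq : Tendsto (fun N ↦ ∫ ω, x 0 ω ^ 2 * D N (x 0 ω, ζ 0 ω) ^ 2 ∂μ) atTop (𝓝 0) := by
    refine h.tendsto_integral_sq_mul (fun N ↦ (hDpm N).pow_const 2) (B := 9) (fun N ω ↦ ?_) ?_
    · rw [abs_of_nonneg (sq_nonneg _), ← sq_abs]
      nlinarith [hD3 N (x 0 ω, ζ 0 ω), abs_nonneg (D N (x 0 ω, ζ 0 ω))]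
    · filter_upwards [hne] with ω hω
      have hc := tendsto_scale_mul a (x 0 ω)
      have := (((tendsto_sign_sub hω).comp hc).sub_const (Real.sign (ζ 0 ω))).sub
        ((tendsto_signMean hmed hF).comp hc)
      simpa using this.pow 2
  have hsqrt : Tendsto (fun N ↦ √(∫ ω, (x 0 ω * D N (x 0 ω, ζ 0 ω)) ^ 2 ∂μ)) atTop (𝓝 0) := by
    have := (Real.continuous_sqrt.tendsto 0).comp hsq
    rw [Real.sqrt_zero] at this
    refine this.congr fun N ↦ ?_
    simp only [Function.comp_apply, mul_pow]
  refine squeeze_zero (fun N ↦ integral_nonneg fun ω ↦ abs_nonneg _) (fun N ↦ ?_) hsqrt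
  have hL : MemLp (fun ω ↦ x 0 ω * D N (x 0 ω, ζ 0 ω)) 2 μ := by
    refine (h.memLp.const_mul 3).mono ((hxm 0).mul (hDpm N)).aestronglyMeasurable
      (ae_of_all _ fun ω ↦ ?_)
    rw [norm_mul, norm_mul, mul_comm]
    gcongr
    simpa using hD3 N (x 0 ω, ζ 0 ω)
  have hb := h.integral_abs_sum_le (Φ := fun p ↦ p.1 * D N p) (by fun_prop)
    (fun b ↦ by rw [integral_const_mul, ← hν, hD0, mul_zero]) hL N
  simp_rw [abs_mul (scale N), abs_of_pos (scale_pos N)]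
  rw [integral_const_mul]
  calc _ ≤ scale N * (√N * √(∫ ω, (x 0 ω * D N (x 0 ω, ζ 0 ω)) ^ 2 ∂μ)) :=
        mul_le_mul_of_nonneg_left hb (scale_pos N).le
    _ = (scale N * √N) * √(∫ ω, (x 0 ω * D N (x 0 ω, ζ 0 ω)) ^ 2 ∂μ) := by ring
    _ ≤ 1 * √(∫ ω, (x 0 ω * D N (x 0 ω, ζ 0 ω)) ^ 2 ∂μ) := by
        gcongr
        rw [scale, inv_mul_le_iff₀ (by positivity), mul_one]
        exact Real.sqrt_le_sqrt (by linarith)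
    _ = _ := one_mul _

/-- The conditional means of the increments of the score are asymptotically linear. -/
theorem tendsto_integral_abs_drift [IsProbabilityMeasure μ] (h : CausalAR1 μ θ x ζ ℱ)
    [NullSingletonClass (μ.map (ζ 0))] (hmed : IsMedian (μ.map (ζ 0)) 0) {f : ℝ → ℝ}
    (hF : LocalExpansionAtZero (cdf (μ.map (ζ 0))) f) (a : ℝ) :
    Tendsto (fun N ↦ ∫ ω, |scale N * ∑ s ∈ Finset.range N, x s ω *
      (signMean (μ.map (ζ 0)) (a * (scale N * x s ω)) + 2 * f 0 * (a * (scale N * x s ω)))| ∂μ)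
      atTop (𝓝 0) := by
  have hxm := h.measurable
  have hζm := h.measurable_innov
  set ν := μ.map (ζ 0) with hν
  have : IsProbabilityMeasure ν := Measure.isProbabilityMeasure_map (hζm 0).aemeasurable
  obtain ⟨⟨B, hB⟩, hr0⟩ := exists_signMeanErr_le hmed hF
  set r := signMeanErr ν (f 0) with hr
  have hrm : Measurable r := measurable_signMeanErr ν (f 0)
  have hrn y : 0 ≤ r y := signMeanErr_nonneg ν (f 0) y
  have hrB y : |r y| ≤ B := by rw [abs_of_nonneg (hrn y)]; exact hB y
  have hsq : Tendsto (fun N ↦ |a| * ∫ ω, x 0 ω ^ 2 * r (a * (scale N * x 0 ω)) ∂μ) atTop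
      (𝓝 0) := by
    have := (h.tendsto_integral_sq_mul (w := fun N ω ↦ r (a * (scale N * x 0 ω)))
      (fun N ↦ hrm.comp (by fun_prop)) (fun N ω ↦ hrB _)
      (ae_of_all _ fun ω ↦ hr0.comp (tendsto_scale_mul a (x 0 ω)))).const_mul |a|
    simpa using this
  refine squeeze_zero (fun N ↦ integral_nonneg fun ω ↦ abs_nonneg _) (fun N ↦ ?_) hsq
  have hint s : Integrable (fun ω ↦ x s ω ^ 2 * r (a * (scale N * x s ω))) μ := by
    refine ((h.memLp_x s).integrable_sq.mul_const B).mono'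
      (((hxm s).pow_const 2).mul (hrm.comp (by fun_prop))).aestronglyMeasurable
      (ae_of_all _ fun ω ↦ ?_)
    rw [Real.norm_eq_abs, abs_mul, abs_of_nonneg (sq_nonneg _)]
    gcongr
    exact hrB _
  have hpt ω : |scale N * ∑ s ∈ Finset.range N, x s ω *
      (signMean ν (a * (scale N * x s ω)) + 2 * f 0 * (a * (scale N * x s ω)))|
      ≤ (|a| * scale N ^ 2) * ∑ s ∈ Finset.range N, x s ω ^ 2 * r (a * (scale N * x s ω)) := by
    rw [abs_mul, abs_of_pos (scale_pos N), sq, mul_left_comm, mul_assoc (scale N)]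
    refine mul_le_mul_of_nonneg_left ?_ (scale_pos N).le
    rw [Finset.mul_sum]
    refine (Finset.abs_sum_le_sum_abs _ _).trans (Finset.sum_le_sum fun s _ ↦ le_of_eq ?_)
    rw [abs_mul, abs_signMean_add hmed, abs_mul, abs_mul, abs_of_pos (scale_pos N),
      ← sq_abs (x s ω)]
    ring
  refine (integral_mono_of_nonneg (ae_of_all _ fun ω ↦ abs_nonneg _)
    ((integrable_finsetSum _ fun s _ ↦ hint s).const_mul _) (ae_of_all _ hpt)).trans ?_
  have hid s : ∫ ω, x s ω ^ 2 * r (a * (scale N * x s ω)) ∂μ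
      = ∫ ω, x 0 ω ^ 2 * r (a * (scale N * x 0 ω)) ∂μ :=
    ((h.ident s).comp (u := fun y ↦ y ^ 2 * r (a * (scale N * y)))
      ((measurable_id.pow_const 2).mul (hrm.comp (by fun_prop)))).integral_eq
  rw [integral_const_mul, integral_finsetSum _ fun s _ ↦ hint s, Finset.sum_congr rfl
    fun s _ ↦ hid s, Finset.sum_const, Finset.card_range, nsmul_eq_mul, scale_sq, mul_assoc,
    ← mul_assoc (_⁻¹)]
  have hI : 0 ≤ ∫ ω, x 0 ω ^ 2 * r (a * (scale N * x 0 ω)) ∂μ :=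
    integral_nonneg fun ω ↦ mul_nonneg (sq_nonneg _) (hrn _)
  refine mul_le_mul_of_nonneg_left (mul_le_of_le_one_left hI ?_) (abs_nonneg _)
  rw [← div_eq_inv_mul, div_le_one (by positivity)]
  linarith

/-- Asymptotic linearity of the score in the local parameter `a`. -/
theorem tendsto_integral_abs_ladScore_sub [IsProbabilityMeasure μ] (h : CausalAR1 μ θ x ζ ℱ)
    [NullSingletonClass (μ.map (ζ 0))] (hmed : IsMedian (μ.map (ζ 0)) 0) {f : ℝ → ℝ}
    (hF : LocalExpansionAtZero (cdf (μ.map (ζ 0))) f) (a : ℝ) :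
    Tendsto (fun N ↦ ∫ ω, |ladScore x ζ a N ω
      - (signScore x ζ N ω - 2 * f 0 * (∫ ω, x 0 ω ^ 2 ∂μ) * a)| ∂μ) atTop (𝓝 0) := by
  have hxm := h.measurable
  have hζm := h.measurable_innov
  set ν := μ.map (ζ 0) with hν
  have : IsProbabilityMeasure ν := Measure.isProbabilityMeasure_map (hζm 0).aemeasurable
  have hg := measurable_signMean ν
  set v := ∫ ω, x 0 ω ^ 2 ∂μ with hv
  set T1 : ℕ → Ω → ℝ := fun N ω ↦ scale N * ∑ s ∈ Finset.range N, x s ω *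
      (Real.sign (ζ s ω - a * (scale N * x s ω)) - Real.sign (ζ s ω)
        - signMean ν (a * (scale N * x s ω))) with hT1
  set T2 : ℕ → Ω → ℝ := fun N ω ↦ scale N * ∑ s ∈ Finset.range N, x s ω *
      (signMean ν (a * (scale N * x s ω)) + 2 * f 0 * (a * (scale N * x s ω))) with hT2
  set T3 : ℕ → Ω → ℝ := fun N ω ↦
    ((N : ℝ) + 1)⁻¹ * ∑ s ∈ Finset.range N, x s ω ^ 2 - v with hT3
  have hxi s : Integrable (x s) μ := (h.memLp_x s).integrable one_le_two
  have hx2 s : Integrable (fun ω ↦ x s ω ^ 2) μ := (h.memLp_x s).integrable_sq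
  have i1 N : Integrable (T1 N) μ := by
    refine (integrable_finsetSum _ fun s _ ↦ ?_).const_mul _
    refine (hxi s).mul_bdd (c := 3) (Measurable.aestronglyMeasurable (by fun_prop))
      (ae_of_all _ fun ω ↦ ?_)
    have h1 := abs_le.1 (abs_sign_le_one (ζ s ω - a * (scale N * x s ω)))
    have h2 := abs_le.1 (abs_sign_le_one (ζ s ω))
    have h3 := abs_le.1 (abs_signMean_le_one ν (a * (scale N * x s ω)))
    rw [Real.norm_eq_abs, abs_le]
    constructor <;> linarith [h1.1, h1.2, h2.1, h2.2, h3.1, h3.2]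
  have i2 N : Integrable (T2 N) μ := by
    refine (integrable_finsetSum _ fun s _ ↦ ?_).const_mul _
    have e : (fun ω ↦ x s ω * (signMean ν (a * (scale N * x s ω))
          + 2 * f 0 * (a * (scale N * x s ω))))
        = fun ω ↦ x s ω * signMean ν (a * (scale N * x s ω))
          + (2 * f 0 * a * scale N) * x s ω ^ 2 := by
      funext ω; ring
    rw [e]
    exact ((hxi s).mul_bdd (c := 1) (Measurable.aestronglyMeasurable (by fun_prop))
      (ae_of_all _ fun ω ↦ abs_signMean_le_one _ _)).add ((hx2 s).const_mul _)
  have i3 N : Integrable (T3 N) μ :=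
    ((integrable_finsetSum _ fun s _ ↦ hx2 s).const_mul _).sub (integrable_const v)
  have hlim : Tendsto (fun N ↦ ∫ ω, |T1 N ω| ∂μ + ∫ ω, |T2 N ω| ∂μ
      + |2 * f 0 * a| * ∫ ω, |T3 N ω| ∂μ) atTop (𝓝 0) := by
    have := ((h.tendsto_integral_abs_martingale hmed hF a).add
      (h.tendsto_integral_abs_drift hmed hF a)).add
      (h.tendsto_integral_abs_sq.const_mul |2 * f 0 * a|)
    simpa only [add_zero, mul_zero] using this
  refine squeeze_zero (fun N ↦ integral_nonneg fun ω ↦ abs_nonneg _) (fun N ↦ ?_) hlim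
  have hsplit ω : ladScore x ζ a N ω - (signScore x ζ N ω - 2 * f 0 * v * a)
      = T1 N ω + T2 N ω - 2 * f 0 * a * T3 N ω := by
    simp only [hT1, hT2, hT3, ladScore, signScore]
    rw [← mul_add, ← Finset.sum_add_distrib, ← scale_sq]
    have e : ∑ s ∈ Finset.range N, (x s ω * (Real.sign (ζ s ω - a * (scale N * x s ω))
          - Real.sign (ζ s ω) - signMean ν (a * (scale N * x s ω)))
        + x s ω * (signMean ν (a * (scale N * x s ω)) + 2 * f 0 * (a * (scale N * x s ω))))
        = ∑ s ∈ Finset.range N, x s ω * Real.sign (ζ s ω - a * (scale N * x s ω))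
          - ∑ s ∈ Finset.range N, x s ω * Real.sign (ζ s ω)
          + (2 * f 0 * a * scale N) * ∑ s ∈ Finset.range N, x s ω ^ 2 := by
      rw [Finset.mul_sum, ← Finset.sum_sub_distrib, ← Finset.sum_add_distrib]
      exact Finset.sum_congr rfl fun s _ ↦ by ring
    rw [e]
    ring
  have i12 : Integrable (fun ω ↦ |T1 N ω| + |T2 N ω|) μ := (i1 N).abs.add (i2 N).abs
  rw [← integral_const_mul |2 * f 0 * a|, ← integral_add (i1 N).abs (i2 N).abs,
    ← integral_add i12 ((i3 N).abs.const_mul _)]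
  refine integral_mono_of_nonneg (ae_of_all _ fun ω ↦ abs_nonneg _)
    (i12.add ((i3 N).abs.const_mul _)) (ae_of_all _ fun ω ↦ ?_)
  simp only [hsplit]
  refine (abs_sub _ _).trans ?_
  rw [abs_mul (2 * f 0 * a)]
  gcongr
  exact abs_add_le _ _

/-- The score at the local parameter `a` is asymptotically Gaussian, with a drift linear in `a`. -/
theorem tendstoInDistribution_ladScore [IsProbabilityMeasure μ] (h : CausalAR1 μ θ x ζ ℱ)
    [NullSingletonClass (μ.map (ζ 0))] (hmed : IsMedian (μ.map (ζ 0)) 0) {f : ℝ → ℝ}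
    (hF : LocalExpansionAtZero (cdf (μ.map (ζ 0))) f) (a : ℝ) :
    TendstoInDistribution (ladScore x ζ a) atTop
      (fun w : ℝ ↦ w - 2 * f 0 * (∫ ω, x 0 ω ^ 2 ∂μ) * a) (fun _ ↦ μ)
      (gaussianReal 0 (∫ ω, x 0 ω ^ 2 ∂μ).toNNReal) := by
  have hζm := h.measurable_innov
  have : IsProbabilityMeasure (μ.map (ζ 0)) :=
    Measure.isProbabilityMeasure_map (hζm 0).aemeasurable
  set b := 2 * f 0 * (∫ ω, x 0 ω ^ 2 ∂μ) * a with hb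
  have hW := (h.tendstoInDistribution_signScore (integral_exp_sign hmed)).continuous_comp
    (g := fun w ↦ w - b) (by fun_prop)
  have hSm := h.measurable_signScore
  have hLm := h.measurable_ladScore a
  refine tendstoInDistribution_of_tendstoInMeasure_sub
    (X := fun N ω ↦ signScore x ζ N ω - b) (ladScore x ζ a) _ hW ?_ fun N ↦ (hLm N).aemeasurable
  refine tendstoInMeasure_of_tendsto_eLpNorm one_ne_zero
    (fun N ↦ ((hLm N).sub ((hSm N).sub_const b)).aestronglyMeasurable)
    aestronglyMeasurable_zero ?_
  have := (ENNReal.tendsto_ofReal (h.tendsto_integral_abs_ladScore_sub hmed hF a))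
  rw [ENNReal.ofReal_zero] at this
  refine this.congr fun N ↦ ?_
  have hxi s : Integrable (x s) μ := (h.memLp_x s).integrable one_le_two
  have hxm := h.measurable
  have iL : Integrable (ladScore x ζ a N) μ := by
    refine (integrable_finsetSum _ fun s _ ↦ ?_).const_mul _
    exact (hxi s).mul_bdd (c := 1) (Measurable.aestronglyMeasurable (by fun_prop))
      (ae_of_all _ fun ω ↦ abs_sign_le_one _)
  have iS : Integrable (signScore x ζ N) μ := by
    refine (integrable_finsetSum _ fun s _ ↦ ?_).const_mul _
    exact (hxi s).mul_bdd (c := 1) (Measurable.aestronglyMeasurable (by fun_prop))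
      (ae_of_all _ fun ω ↦ abs_sign_le_one _)
  rw [sub_zero, eLpNorm_one_eq_lintegral_enorm]
  exact ofReal_integral_norm_eq_lintegral_enorm (iL.sub (iS.sub (integrable_const b)))

end CausalAR1
end LADAR1

/-! ### From the score to the minimizer -/

namespace LADAR1
open scoped Topology

/-- Convergence of distribution functions at every point implies weak convergence. -/
theorem tendsto_of_forall_tendsto_Iic {P : ℕ → ProbabilityMeasure ℝ} {Q : ProbabilityMeasure ℝ}
    (h : ∀ a, Tendsto (fun n ↦ (P n : Measure ℝ).real (Set.Iic a)) atTop
      (𝓝 ((Q : Measure ℝ).real (Set.Iic a)))) :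
    Tendsto P atTop (𝓝 Q) := by
  refine (isPiSystem_Ioc (id : ℝ → ℝ) (id : ℝ → ℝ)).tendsto_probabilityMeasure_of_tendsto_of_mem
    ?_ ?_ ?_
  · rintro s ⟨a, b, -, rfl⟩
    exact measurableSet_Ioc
  · intro u hu y hy
    obtain ⟨ε, hε, hball⟩ := Metric.isOpen_iff.1 hu y hy
    refine ⟨Set.Ioc (y - ε / 2) (y + ε / 2), ⟨y - ε / 2, y + ε / 2, by simp; linarith, rfl⟩,
      Ioc_mem_nhds (by linarith) (by linarith), fun w hw ↦ hball ?_⟩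
    rw [Metric.mem_ball, Real.dist_eq, abs_lt]
    constructor <;> linarith [hw.1, hw.2]
  · rintro s ⟨a, b, hab, rfl⟩
    have hab' : a ≤ b := le_of_lt hab
    have e (R : ProbabilityMeasure ℝ) : (R : Measure ℝ).real (Set.Ioc a b)
        = (R : Measure ℝ).real (Set.Iic b) - (R : Measure ℝ).real (Set.Iic a) := by
      rw [← Set.Iic_sdiff_Iic, measureReal_sdiff (Set.Iic_subset_Iic.2 hab') measurableSet_Iic]
    rw [← NNReal.tendsto_coe]
    have := (h b).sub (h a)
    simp_rw [← e] at this
    exact this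

theorem abs_eq_mul_sign (w : ℝ) : |w| = w * Real.sign w := by
  rcases lt_trichotomy w 0 with h | rfl | h
  · rw [abs_of_neg h, Real.sign_of_neg h]; ring
  · simp
  · rw [abs_of_pos h, Real.sign_of_pos h]; ring

/-- `Real.sign w` is a subgradient of the absolute value at `w`. -/
theorem mul_sign_le_abs (w w' : ℝ) : w' * Real.sign w ≤ |w'| := by
  refine (le_abs_self _).trans ?_
  rw [abs_mul]
  exact mul_le_of_le_one_right (abs_nonneg _) (abs_sign_le_one _)

/-- By convexity, at a minimizer `b` of `∑ |z s - b * y s|` the subgradient taken at `a` points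
towards `b`. -/
theorem mul_sum_sign_nonneg {ι : Type*} {S : Finset ι} {z y : ι → ℝ} {a b : ℝ}
    (h : ∑ s ∈ S, |z s - b * y s| ≤ ∑ s ∈ S, |z s - a * y s|) :
    0 ≤ (b - a) * ∑ s ∈ S, y s * Real.sign (z s - a * y s) := by
  have key : ∑ s ∈ S, |z s - a * y s| - (b - a) * ∑ s ∈ S, y s * Real.sign (z s - a * y s)
      ≤ ∑ s ∈ S, |z s - b * y s| := by
    rw [Finset.mul_sum, ← Finset.sum_sub_distrib]
    refine Finset.sum_le_sum fun s _ ↦ ?_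
    rw [abs_eq_mul_sign (z s - a * y s)]
    refine le_trans (le_of_eq ?_) (mul_sign_le_abs (z s - a * y s) (z s - b * y s))
    ring
  linarith

variable {Ω : Type*} [mΩ : MeasurableSpace Ω] {μ : Measure Ω}

/-- Estimators located by the sign of a score process inherit the asymptotic distribution of the
zero of the limiting score `a ↦ w - k * a`. -/
theorem tendstoInDistribution_of_score [IsProbabilityMeasure μ] {U : ℕ → Ω → ℝ}
    {S : ℝ → ℕ → Ω → ℝ} {k : ℝ} (hk : 0 < k) {σ τ : NNReal} (hσ : σ ≠ 0)
    (hτ : (τ : ℝ) = σ / k ^ 2)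
    (hU : ∀ N, AEMeasurable (U N) μ)
    (hUS : ∀ a N, ∀ᵐ ω ∂μ, 0 ≤ (U N ω - a) * S a N ω)
    (hS : ∀ a, TendstoInDistribution (S a) atTop (fun w : ℝ ↦ w - k * a) (fun _ ↦ μ)
      (gaussianReal 0 σ)) :
    TendstoInDistribution U atTop (id : ℝ → ℝ) (fun _ ↦ μ)
      (gaussianReal 0 τ) := by
  have : NullSingletonClass (gaussianReal 0 σ) := nullSingletonClass_gaussianReal hσ
  set G := gaussianReal 0 σ with hG
  have hmk : Measurable fun w : ℝ ↦ w / k := by fun_prop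
  set H := gaussianReal 0 τ with hH
  have hmap : G.map (· / k) = H := by
    rw [hG, gaussianReal_map_div_const, zero_div, hH]
    congr 1
    exact NNReal.eq hτ.symm
  have hHIic a : H (Set.Iic a) = G (Set.Iic (k * a)) := by
    rw [← hmap, Measure.map_apply hmk measurableSet_Iic]
    congr 1
    ext w
    simp [div_le_iff₀ hk, mul_comm]
  -- limits of the probabilities that the score is negative, or nonpositive
  have hport a {E : Set ℝ} (hEm : MeasurableSet E) (hE : frontier E = {0}) :
      Tendsto (fun N ↦ μ (S a N ⁻¹' E)) atTop (𝓝 (G ((fun w ↦ w - k * a) ⁻¹' E))) := by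
    have hm : Measurable fun w : ℝ ↦ w - k * a := by fun_prop
    have := ProbabilityMeasure.tendsto_measure_of_null_frontier_of_tendsto' (hS a).tendsto (E := E)
      (by
        rw [hE, ProbabilityMeasure.coe_mk, Measure.map_apply hm (measurableSet_singleton 0)]
        have e : (fun w ↦ w - k * a) ⁻¹' {0} = {k * a} := by
          ext w; simp [sub_eq_zero]
        rw [e, measure_singleton])
    simp only [ProbabilityMeasure.coe_mk] at this
    rw [Measure.map_apply hm hEm] at this
    refine this.congr fun N ↦ ?_
    rw [Measure.map_apply_of_aemeasurable ((hS a).forall_aemeasurable N) hEm]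
  have hneg a : Tendsto (fun N ↦ μ (S a N ⁻¹' Set.Iio 0)) atTop (𝓝 (H (Set.Iic a))) := by
    have e : G ((fun w ↦ w - k * a) ⁻¹' Set.Iio 0) = H (Set.Iic a) := by
      rw [hHIic, ← measure_congr (Iio_ae_eq_Iic (μ := G) (a := k * a))]
      congr 1
      ext w; simp
    rw [← e]
    exact hport a measurableSet_Iio frontier_Iio
  have hnonpos a : Tendsto (fun N ↦ μ (S a N ⁻¹' Set.Iic 0)) atTop (𝓝 (H (Set.Iic a))) := by
    have e : G ((fun w ↦ w - k * a) ⁻¹' Set.Iic 0) = H (Set.Iic a) := by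
      rw [hHIic]
      congr 1
      ext w; simp
    rw [← e]
    exact hport a measurableSet_Iic frontier_Iic
  have hlower a N : μ (S a N ⁻¹' Set.Iio 0) ≤ μ (U N ⁻¹' Set.Iic a) := by
    refine measure_mono_ae ?_
    filter_upwards [hUS a N] with ω hω (hneg : S a N ω < 0)
    change U N ω ≤ a
    by_contra hlt
    rw [not_le] at hlt
    nlinarith
  -- At `S b N ω = 0` the score does not locate the minimizer; this is why the upper bound is taken
  -- at `b > a`, and it is recovered by right continuity of the limit distribution function.
  have hupper a b N (hab : a < b) : μ (U N ⁻¹' Set.Iic a) ≤ μ (S b N ⁻¹' Set.Iic 0) := by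
    refine measure_mono_ae ?_
    filter_upwards [hUS b N] with ω hω (hle : U N ω ≤ a)
    change S b N ω ≤ 0
    by_contra hlt
    rw [not_le] at hlt
    nlinarith
  have hcdf a : Tendsto (fun N ↦ μ (U N ⁻¹' Set.Iic a)) atTop (𝓝 (H (Set.Iic a))) := by
    rw [tendsto_order]
    constructor
    · intro r hr
      filter_upwards [(hneg a).eventually_const_lt hr] with N hN
      exact hN.trans_le (hlower a N)
    · intro r hr
      have hright : Tendsto (fun b ↦ H (Set.Iic b)) (𝓝[>] a) (𝓝 (H (Set.Iic a))) := by
        have hc := ((cdf H).right_continuous a).tendsto.mono_left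
          (nhdsWithin_mono a Set.Ioi_subset_Ici_self)
        have := ENNReal.tendsto_ofReal hc
        simpa only [ofReal_cdf] using this
      obtain ⟨b, hbr, hab⟩ := ((hright.eventually_lt_const hr).and self_mem_nhdsWithin).exists
      filter_upwards [(hnonpos b).eventually_lt_const hbr] with N hN
      exact (hupper a b N hab).trans_lt hN
  refine ⟨hU, aemeasurable_id, tendsto_of_forall_tendsto_Iic fun a ↦ ?_⟩
  simp only [ProbabilityMeasure.coe_mk, Measure.map_id, measureReal_def]
  refine ((ENNReal.tendsto_toReal (measure_ne_top _ _)).comp (hcdf a)).congr fun N ↦ ?_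
  rw [Function.comp_apply, Measure.map_apply_of_aemeasurable (hU N) measurableSet_Iic]

/-- In the local parameter `b = (θ' - θ) / scale N`, the criterion of the sample of size `N + 1`
is a sum of absolute values of perturbed innovations. -/
theorem ladCriterion_eq {X x ζ : ℕ → ℝ} {θ : ℝ} (hx : ∀ t, X (t + 1) = x t)
    (hrec : ∀ t, x (t + 1) = θ * x t + ζ t) (N : ℕ) (b : ℝ) :
    ladCriterion X (N + 1) (θ + b * scale N)
      = 1 / ((N : ℝ) + 1) * ∑ s ∈ Finset.range N, |ζ s - b * (scale N * x s)| := by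
  have e : Finset.Icc 2 (N + 1) = Finset.Ico (0 + 2) (N + 2) := by
    ext t; simp; omega
  rw [ladCriterion, e, ← Finset.sum_Ico_add' (fun t ↦ |X t - (θ + b * scale N) * X (t - 1)|) 0 N 2,
    Finset.range_eq_Ico]
  push_cast
  congr 1
  refine Finset.sum_congr rfl fun s _ ↦ ?_
  have h1 : X (s + 2) = θ * x s + ζ s := by rw [← hrec, ← hx]
  have h2 : X (s + 1) = x s := hx s
  rw [h1, h2]
  congr 1
  ring

/-- If `x 0` vanished almost surely, so would `x 1` by stationarity and then the innovation `ζ 0`,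
which has no atoms. -/
theorem CausalAR1.integral_sq_pos [IsProbabilityMeasure μ] {θ : ℝ} {x ζ : ℕ → Ω → ℝ}
    {ℱ : Filtration ℕ mΩ} (h : CausalAR1 μ θ x ζ ℱ) [NullSingletonClass (μ.map (ζ 0))] :
    0 < ∫ ω, x 0 ω ^ 2 ∂μ := by
  refine (integral_nonneg fun ω ↦ sq_nonneg _).lt_of_ne fun h0 ↦ ?_
  have hx0 : x 0 =ᵐ[μ] 0 := by
    have := (integral_eq_zero_iff_of_nonneg (fun ω ↦ sq_nonneg (x 0 ω)) h.memLp.integrable_sq).1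
      h0.symm
    filter_upwards [this] with ω hω
    simpa using hω
  have hx1 : ∀ᵐ ω ∂μ, x 1 ω = 0 :=
    (h.ident 1).symm.ae_snd (p := fun y ↦ y = 0) (measurableSet_singleton 0) hx0
  have hne : ∀ᵐ ω ∂μ, ζ 0 ω ≠ 0 :=
    ae_of_ae_map (h.measurable_innov 0).aemeasurable (p := fun z ↦ z ≠ 0)
      ((μ.map (ζ 0)).ae_ne 0)
  have : ∀ᵐ ω ∂μ, False := by
    filter_upwards [hx0, hx1, hne] with ω h1 h2 h3
    have := h.recursion 0 ω
    rw [zero_add, h2, h1] at this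
    exact h3 (by simpa using this.symm)
  exact IsProbabilityMeasure.ne_zero μ (by simpa using this)

end LADAR1

theorem theorem2 {Ω : Type*} [MeasurableSpace Ω] (μ : Measure Ω) [IsProbabilityMeasure μ]
    (θ₀ : ℝ) (X Z : ℕ → Ω → ℝ) (hX : LADAR1.IsStationaryAR1 μ θ₀ X Z)
    (hmed : LADAR1.IsMedian (μ.map (Z 1)) 0)
    (f : ℝ → ℝ) (hf : LADAR1.IsDensityOf μ f (Z 1))
    (hf_cont : ContinuousAt f 0) (hf_pos : 0 < f 0)
    (hF : LADAR1.LocalExpansionAtZero (cdf (μ.map (Z 1))) f)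
    (θhat : ℕ → Ω → ℝ) (hθ : LADAR1.IsLADEstimator μ X θhat) :
    MemLp (X 1) 2 μ ∧ 0 < ∫ ω, (X 1 ω) ^ 2 ∂μ ∧
      TendstoInDistribution (fun (n : ℕ) ω ↦ √(n : ℝ) * (θhat n ω - θ₀)) atTop
        (id : ℝ → ℝ) (fun _ ↦ μ)
        (gaussianReal 0 (1 / (4 * (f 0) ^ 2 * ∫ ω, (X 1 ω) ^ 2 ∂μ)).toNNReal) := by
  -- The criterion starts at `X 1`, so the process is shifted by one.
  obtain ⟨x, ζ, hreg, hXx, hZζ⟩ := hX.shift.exists_regular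
  obtain ⟨ℱ, h⟩ := hreg.exists_causal
  have hlaw : μ.map (Z 1) = μ.map (ζ 0) := by
    rw [← Measure.map_congr (hZζ 0)]
    exact (hX.ident 1).map_eq.symm
  have hatom : NullSingletonClass (μ.map (ζ 0)) := by
    rw [← hlaw, hf.hasLaw.map_eq]
    infer_instance
  rw [hlaw] at hmed hF
  have hvX : ∫ ω, X 1 ω ^ 2 ∂μ = ∫ ω, x 0 ω ^ 2 ∂μ :=
    integral_congr_ae ((hXx 0).mono fun ω hω ↦ by simp only [← hω, zero_add])
  have hv : 0 < ∫ ω, x 0 ω ^ 2 ∂μ := h.integral_sq_pos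
  refine ⟨h.memLp.ae_eq (hXx 0).symm, hvX ▸ hv, ?_⟩
  rw [hvX]
  set v := ∫ ω, x 0 ω ^ 2 ∂μ with hvdef
  have hUm (n : ℕ) : AEMeasurable (fun ω ↦ √(n : ℝ) * (θhat n ω - θ₀)) μ :=
    ((hθ.aemeasurable n).sub_const _).const_mul _
  have hsucc : TendstoInDistribution
      (fun (N : ℕ) ω ↦ √((N + 1 : ℕ) : ℝ) * (θhat (N + 1) ω - θ₀)) atTop (id : ℝ → ℝ) (fun _ ↦ μ)
      (gaussianReal 0 (1 / (4 * (f 0) ^ 2 * v)).toNNReal) := by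
    refine LADAR1.tendstoInDistribution_of_score (S := LADAR1.ladScore x ζ) (k := 2 * f 0 * v)
      (σ := v.toNNReal) (by positivity) (by simpa using hv) ?_ (fun N ↦ hUm (N + 1)) ?_
      (h.tendstoInDistribution_ladScore hmed hF)
    · rw [Real.coe_toNNReal _ hv.le, Real.coe_toNNReal _ (by positivity)]
      field_simp
      ring
    · intro a N
      filter_upwards [hθ.isMin (N + 1), ae_all_iff.2 hXx] with ω hmin hω
      have hc := LADAR1.scale_pos N
      have hsc : √((N + 1 : ℕ) : ℝ) * LADAR1.scale N = 1 := by
        rw [LADAR1.scale]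
        push_cast
        exact mul_inv_cancel₀ (by positivity)
      have hb : θhat (N + 1) ω
          = θ₀ + √((N + 1 : ℕ) : ℝ) * (θhat (N + 1) ω - θ₀) * LADAR1.scale N := by
        linear_combination -(θhat (N + 1) ω - θ₀) * hsc
      have hle := hmin (θ₀ + a * LADAR1.scale N)
      rw [hb, LADAR1.ladCriterion_eq hω (fun t ↦ h.recursion t ω),
        LADAR1.ladCriterion_eq hω (fun t ↦ h.recursion t ω)] at hle
      have := LADAR1.mul_sum_sign_nonneg (le_of_mul_le_mul_left hle (by positivity))
      rw [LADAR1.ladScore, Finset.mul_sum]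
      simpa only [mul_assoc] using this
  exact ⟨hUm, aemeasurable_id, (tendsto_add_atTop_iff_nat 1).1 hsucc.tendsto⟩
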